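/- Let $F$ be a field of characteristic $0$, $L$ an $F$-vector space with basis $e_1,e_2,\dots$, and $E$ the Grassmann algebra of $L$, with its basis of monomials $e_{i_1}\cdots e_{i_n}$, $i_1<\dots<i_n$, $n\ge 0$. Each map $i\mapsto\|e_i\|$ from $\{1,2,\dots\}$ to an abelian group $G$ induces a $G$-grading of $E$: the component of degree $g$ is spanned by the monomials with $\|e_{i_1}\|+\dots+\|e_{i_n}\|=g$. Let $a,b$ be positive integers and $c$ an integer with $-b<c<a$. For $k\in\{0,1,2,\dots\}\cup\{\infty\}$ let $E_{(-b,c,a)}^{(\infty,k,\infty)}$ be $E$ with a $\mathbb Z$-grading induced in this way, in which exactly $k$ of the $e_i$ have degree $c$, infinitely many have degree $-b$, infinitely many have degree $a$, and there are no others. A $\mathbb Z$-grading $E=\bigoplus_{r\in\mathbb Z} A_r$ is called $2$-central if every $e_i$ is homogeneous, $A_r\neq 0$ for all $r\in\mathbb Z$, and for each even $r$ the component $A_r$ contains infinitely many monomials of even length with pairwise disjoint supports. Let $F\langle X|G\rangle$ be the free unital associative $F$-algebra on the variables $x_i^g$ ($i\ge 1$, $g\in G$), graded by $\deg x_i^g=g$.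 For a $G$-graded algebra $A=\bigoplus_g A_g$ let $T_G(A)$ be the set of its graded identities, i.e. of the $f\in F\langle X|G\rangle$ that vanish under all substitutions of elements of $A_g$ for the variables of degree $g$. A $T_G$-ideal is a two-sided ideal invariant under all graded endomorphisms of $F\langle X|G\rangle$. For the variety $\mathfrak V$ of $G$-graded algebras defined by a set $S\subseteq F\langle X|G\rangle$, $T_G(\mathfrak V)$ is the $T_G$-ideal generated by $S$; $A$ generates $\mathfrak V$ if $T_G(\mathfrak V)=T_G(A)$. Let $\pi_2\colon F\langle X|\mathbb Z\rangle\to F\langle X|\mathbb Z_2\rangle$ be the homomorphism with $\pi_2(x_i^g)=x_i^{g \bmod 2}$. For an integer $k\ge 0$ let $I_k$ and $I_\infty$ be the ideals of $\mathbb Z_2$-graded identities of the following gradings of $E$: for $I_k$, $\|e_i\|=0$ if $i\le k$ and $\|e_i\|=1$ otherwise; for $I_\infty$, $\|e_i\|=0$ for $i$ even and $\|e_i\|=1$ for $i$ odd. Define varieties of $\mathbb Z$-graded algebras: - $\mathfrak V_{(-1,0,1)}^{(\infty,k,\infty)}$ is defined by the polynomials $f=f(x_1^{g_1},\dots,x_n^{g_n})$,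 $g_1,\dots,g_n\in\mathbb Z$ (so that distinct variables of $f$ have distinct subscripts), with $\pi_2(f)\in I_k$; - $\mathfrak V_{(-1,0,2)}^{(\infty,k,\infty)}$ is defined by the polynomials $f$ of the same form with $\pi_2(f)\in I_\infty$ (it does not depend on $k$); - $\mathfrak V_{can}$ is defined by $x_1x_2-x_2x_1$ whenever at least one of the degrees of $x_1,x_2$ is even, and $x_1x_2+x_2x_1$ whenever both degrees are odd. **Theorem.** Assume $\gcd(a,b)=1$ and $c\ne 0$. Then: 1. For every $k\in\{0,1,2,\dots\}\cup\{\infty\}$, $E_{(-b,c,a)}^{(\infty,k,\infty)}$ is a $2$-central $\mathbb Z$-grading. 2. For every integer $k\ge 0$, $E_{(-b,c,a)}^{(\infty,k,\infty)}$ generates (i) $\mathfrak V_{(-1,0,1)}^{(\infty,k,\infty)}$ if $ab$ is odd and $c$ is even; (ii) $\mathfrak V_{(-1,0,2)}^{(\infty,k,\infty)}$ if $ab$ is even; (iii) $\mathfrak V_{can}$ if $abc$ is odd. 3. $E_{(-b,c,a)}^{(\infty,\infty,\infty)}$ generates (i) $\mathfrak V_{(-1,0,2)}^{(\infty,k,\infty)}$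 (for any $k$) if $abc$ is even; (ii) $\mathfrak V_{can}$ if $abc$ is odd. -/

import Mathlib

/-! ### The infinite dimensional Grassmann algebra -/

/-- The Grassmann algebra `E` over `F` of the vector space `L = ℕ →₀ F` with its fixed countable
basis. -/
abbrev Grassmann (F : Type*) [Field F] : Type _ := ExteriorAlgebra F (ℕ →₀ F)

namespace Grassmann

/-- The generators of `E`: with the numbering `e₁, e₂, …`, this is `e_{i+1}`. -/
noncomputable def gen (F : Type*) [Field F] (i : ℕ) : Grassmann F :=
  ExteriorAlgebra.ι F (Finsupp.single i (1 : F))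

/-- The element of the canonical basis of `E` with support `s`: the product of the generators with
index in `s`, in increasing order. Its length is `s.card`. -/
noncomputable def monomial (F : Type*) [Field F] (s : Finset ℕ) : Grassmann F :=
  ((s.sort (· ≤ ·)).map (gen F)).prod

/-- The components of the grading of `E` induced by degrees `deg i` of the generators: the
component of degree `g` is spanned by the monomials whose generators have total degree `g`. -/
noncomputable def inducedGrading (F : Type*) [Field F] {G : Type*} [AddCommMonoid G]
    (deg : ℕ → G) (g : G) : Submodule F (Grassmann F) :=
  Submodule.span F {w | ∃ s : Finset ℕ, ∑ i ∈ s, deg i = g ∧ w = monomial F s}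

/-- `deg` assigns to every generator one of the pairwise distinct degrees `r 0, …, r (n - 1)`, and
exactly `v j` of the generators get the degree `r j`. The gradings `inducedGrading F deg` with such
a `deg` are the `n`-induced gradings with lower indices `r` and upper indices `v`. -/
structure IsInducedDegree {G : Type*} {n : ℕ} (r : Fin n → G) (v : Fin n → ℕ∞)
    (deg : ℕ → G) : Prop where
  injective : Function.Injective r
  mem_range : ∀ i, ∃ j, deg i = r j
  encard_eq : ∀ j, {i | deg i = r j}.encard = v j

/-- A family of subspaces of `E` is an `H`-central grading. -/
structure IsCentralGrading {F : Type*} [Field F] {G : Type*} [AddCommGroup G] [DecidableEq G]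
    (H : AddSubgroup G) (𝒜 : G → Submodule F (Grassmann F)) : Prop where
  /-- `E` is the direct sum of the components. -/
  isInternal : DirectSum.IsInternal 𝒜
  /-- The components multiply according to their degrees. -/
  gradedMonoid : SetLike.GradedMonoid 𝒜
  /-- The grading is homogeneous: each generator is a homogeneous element. -/
  homogeneous : ∀ i, ∃ g, gen F i ∈ 𝒜 g
  /-- The grading has full support. -/
  full_support : ∀ g, 𝒜 g ≠ ⊥
  /-- Each component with degree in `H` has infinitely many monomials of even length with pairwise
  disjoint supports. -/
  central : ∀ h ∈ H, ∃ T : Set (Finset ℕ), T.Infinite ∧ T.PairwiseDisjoint id ∧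
    ∀ s ∈ T, Even s.card ∧ monomial F s ∈ 𝒜 h

/-- A `d`-central `ℤ`-grading on `E`. -/
def IsIntCentralGrading {F : Type*} [Field F] (d : ℤ)
    (𝒜 : ℤ → Submodule F (Grassmann F)) : Prop :=
  IsCentralGrading (AddSubgroup.zmultiples d) 𝒜

/-- The `ℤ₂`-grading `E_k`: the first `k` generators have degree `0`, the others degree `1`. -/
noncomputable def gradingK (F : Type*) [Field F] (k : ℕ) :
    ZMod 2 → Submodule F (Grassmann F) :=
  inducedGrading F fun i => if i < k then 0 else 1

/-- The `ℤ₂`-grading `E_∞`: in the numbering `e₁, e₂, …`, the generator `e_m` has degree `0` for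
`m` even and degree `1` for `m` odd. -/
noncomputable def gradingInf (F : Type*) [Field F] :
    ZMod 2 → Submodule F (Grassmann F) :=
  inducedGrading F fun i => if Even (i + 1) then 0 else 1

end Grassmann

/-! ### Graded polynomials, graded identities and varieties -/

/-- The free algebra `F⟨X|G⟩`; the generator `(i, g)` is the variable `x_i` of degree `g`. -/
abbrev FreeGraded (F : Type*) [Field F] (G : Type*) : Type _ := FreeAlgebra F (ℕ × G)

namespace FreeGraded

/-- The variable `x_i^g`. -/
def x (F : Type*) [Field F] {G : Type*} (i : ℕ) (g : G) : FreeGraded F G :=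
  FreeAlgebra.ι F (i, g)

/-- The homogeneous component of degree `g` of `F⟨X|G⟩`, spanned by the monomials of degree `g`. -/
def component (F : Type*) [Field F] {G : Type*} [AddCommMonoid G] (g : G) :
    Submodule F (FreeGraded F G) :=
  Submodule.span F {m | ∃ l : List (ℕ × G), (l.map Prod.snd).sum = g ∧
    m = (l.map (FreeAlgebra.ι F)).prod}

/-- `φ` is a `G`-endomorphism of `F⟨X|G⟩`. -/
def IsGradedEnd {F : Type*} [Field F] {G : Type*} [AddCommMonoid G]
    (φ : FreeGraded F G →ₐ[F] FreeGraded F G) : Prop :=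
  ∀ g, ∀ p ∈ component F g, φ p ∈ component F g

/-- A `T_G`-ideal: a two-sided ideal of `F⟨X|G⟩` that is invariant under all `G`-endomorphisms. -/
def IsTIdeal {F : Type*} [Field F] {G : Type*} [AddCommMonoid G]
    (I : TwoSidedIdeal (FreeGraded F G)) : Prop :=
  ∀ φ : FreeGraded F G →ₐ[F] FreeGraded F G, IsGradedEnd φ → ∀ f ∈ I, φ f ∈ I

/-- The `T_G`-ideal generated by a set `S` of graded polynomials. -/
def tIdealSpan {F : Type*} [Field F] {G : Type*} [AddCommMonoid G]
    (S : Set (FreeGraded F G)) : TwoSidedIdeal (FreeGraded F G) :=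
  sInf {I | IsTIdeal I ∧ S ⊆ (I : Set (FreeGraded F G))}

theorem isTIdeal_tIdealSpan {F : Type*} [Field F] {G : Type*} [AddCommMonoid G]
    (S : Set (FreeGraded F G)) : IsTIdeal (tIdealSpan S) := by
  intro φ hφ f hf
  rw [tIdealSpan, TwoSidedIdeal.mem_sInf] at hf ⊢
  exact fun I hI => hI.1 φ hφ f (hf I hI)

/-- `T_G(A)`: the graded polynomials that vanish under every admissible substitution, that is,
every substitution of elements of the component `𝒜 g` for the variables of degree `g`. -/
def identities {F : Type*} [Field F] {G A : Type*} [Ring A] [Algebra F A]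
    (𝒜 : G → Submodule F A) : Set (FreeGraded F G) :=
  {f | ∀ σ : ℕ × G → A, (∀ i g, σ (i, g) ∈ 𝒜 g) → FreeAlgebra.lift F σ f = 0}

/-- The homomorphism `π_d : F⟨X|ℤ⟩ → F⟨X|ℤ_d⟩` that sends `x_i^g` to `x_i^{g mod d}`. -/
def proj (F : Type*) [Field F] (d : ℕ) : FreeGraded F ℤ →ₐ[F] FreeGraded F (ZMod d) :=
  FreeAlgebra.lift F fun p => x F p.1 (p.2 : ZMod d)

/-- `f` has the form `f(x_1^{g_1}, …, x_n^{g_n})`: distinct variables of `f` have distinct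
subscripts. -/
def HasDistinctSubscripts {F : Type*} [Field F] {G : Type*} (f : FreeGraded F G) : Prop :=
  ∃ g : ℕ → G, f ∈ Algebra.adjoin F (Set.range fun i => x F i (g i))

end FreeGraded

/-- A variety of `G`-graded algebras over `F`, represented by its `T_G`-ideal: it is the class of
the `G`-graded algebras that satisfy all the identities in `tIdeal`. -/
structure GradedVariety (F : Type*) [Field F] (G : Type*) [AddCommMonoid G] where
  tIdeal : TwoSidedIdeal (FreeGraded F G)
  isTIdeal : FreeGraded.IsTIdeal tIdeal

namespace GradedVariety

/-- The variety defined by a set of graded polynomials. -/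
def definedBy {F : Type*} [Field F] {G : Type*} [AddCommMonoid G]
    (S : Set (FreeGraded F G)) : GradedVariety F G :=
  ⟨FreeGraded.tIdealSpan S, FreeGraded.isTIdeal_tIdealSpan S⟩

/-- The variety `V` is generated by the algebra with the grading `𝒜`: `T_G(V) = T_G(A)`. -/
def IsGeneratedBy {F : Type*} [Field F] {G : Type*} [AddCommMonoid G] {A : Type*} [Ring A]
    [Algebra F A] (V : GradedVariety F G) (𝒜 : G → Submodule F A) : Prop :=
  (V.tIdeal : Set (FreeGraded F G)) = FreeGraded.identities 𝒜

/-- The variety `𝔙_{(-1,0,1)}^{(∞,k,∞)}`, defined by the `f` with `π₂(f) ∈ T₂(E_k)`. -/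
def var101 (F : Type*) [Field F] (k : ℕ) : GradedVariety F ℤ :=
  definedBy {f | FreeGraded.HasDistinctSubscripts f ∧
    FreeGraded.proj F 2 f ∈ FreeGraded.identities (Grassmann.gradingK F k)}

/-- The variety `𝔙_{(-1,0,2)}^{(∞,k,∞)}`, defined by the `f` with `π₂(f) ∈ T₂(E_∞)`; it does not
depend on `k`. -/
def var102 (F : Type*) [Field F] : GradedVariety F ℤ :=
  definedBy {f | FreeGraded.HasDistinctSubscripts f ∧
    FreeGraded.proj F 2 f ∈ FreeGraded.identities (Grassmann.gradingInf F)}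

open FreeGraded in
/-- The variety `𝔙_can`, defined by `[x₁, x₂]` where one of the degrees is even, and
`x₁ x₂ + x₂ x₁` where both degrees are odd. -/
def varCan (F : Type*) [Field F] : GradedVariety F ℤ :=
  definedBy
    ({f | ∃ g h : ℤ, (Even g ∨ Even h) ∧ f = x F 1 g * x F 2 h - x F 2 h * x F 1 g} ∪
     {f | ∃ g h : ℤ, (Odd g ∧ Odd h) ∧ f = x F 1 g * x F 2 h + x F 2 h * x F 1 g})

end GradedVariety

/-! ### Monomial basis of the Grassmann algebra -/

namespace Grassmann

variable {F : Type*} [Field F]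

/-! Since `gcd(a, b) = 1` and infinitely many generators have each of the degrees `a` and `-b`,
every integer is the degree of a monomial avoiding any prescribed finite set of generators; for an
even degree the length can also be taken even. This is 2-centrality (`HasEvenMonomials`,
`isIntCentralGrading_two`).

Even monomials are central, and this makes the graded identities depend only on degrees mod 2
(`identities_inducedGrading_eq_mod_two`). Let `f` be an identity of the `ℤ`-grading, and let `m` be
a monomial whose degree agrees with `g` only mod 2. For a sum `z` of fresh even monomials of the
missing even degree, `m * z` has degree `g`, so substituting it gives zero. The result is a
polynomial in the central element `z`. If `z` is a sum of `n` disjoint even monomials, then `z ^ n`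
is `n!` times their product and all higher powers vanish, so in characteristic 0 all coefficients of
the polynomial are zero. Putting `z = 1` shows that `f` also vanishes at `m`. The converse inclusion
is coarsening of the grading.

Up to renumbering, a `ℤ₂`-grading of this kind is determined by how many generators are even and how
many are odd. Counting these gives the model gradings `gradingK` and `gradingInf`, whose identities
pulled back to `ℤ` form exactly the T-ideals of `var101` and `var102`
(`tIdealSpan_proj_eq_identities`).

If all degrees are odd, the coarsening is the canonical parity grading. Its identities follow from
the defining relations of `varCan` by eliminating one variable at a time
(`mem_varCan_of_mem_adjoin`). -/

theorem monomial_eq_basis (s : Finset ℕ) :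
    monomial F s = (Finsupp.basisSingleOne (R := F) (ι := ℕ)).ExteriorAlgebra s := by
  rw [ExteriorAlgebra.basis_apply_ofCard (n := s.card) _ rfl, ExteriorAlgebra.ιMulti_family,
    ExteriorAlgebra.ιMulti_apply, monomial]
  congr 1
  apply List.ext_getElem
  · simp
  · intro i h₁ h₂
    simp [gen, Set.powersetCard.ofFinEmbEquiv_symm_apply, Finset.orderEmbOfFin_apply]

theorem linearIndependent_monomial : LinearIndependent F (monomial F) := by
  rw [show monomial F = _ from funext monomial_eq_basis]
  exact Module.Basis.linearIndependent _

theorem span_range_monomial : Submodule.span F (Set.range (monomial F)) = ⊤ := by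
  rw [show monomial F = _ from funext monomial_eq_basis]
  exact Module.Basis.span_eq _

theorem monomial_ne_zero (s : Finset ℕ) : monomial F s ≠ 0 :=
  linearIndependent_monomial.ne_zero s

@[simp]
theorem monomial_empty : monomial F ∅ = 1 := by simp [monomial]

@[simp]
theorem monomial_singleton (i : ℕ) : monomial F {i} = gen F i := by simp [monomial]

theorem monomial_mul_of_not_disjoint {s t : Finset ℕ} (h : ¬Disjoint s t) :
    monomial F s * monomial F t = 0 := by
  rw [monomial_eq_basis, monomial_eq_basis]
  exact ExteriorAlgebra.basis_mul_of_not_disjoint _ (Set.powersetCard.ofCard (s := s) rfl)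
    (Set.powersetCard.ofCard (s := t) rfl) h

theorem monomial_mul_of_disjoint {s t : Finset ℕ} (h : Disjoint s t) :
    ∃ ε : ℤˣ, monomial F s * monomial F t = ε • monomial F (s ∪ t) := by
  have := ExteriorAlgebra.basis_mul_of_disjoint (Finsupp.basisSingleOne (R := F) (ι := ℕ))
    (Set.powersetCard.ofCard (s := s) rfl) (Set.powersetCard.ofCard (s := t) rfl) h
  refine ⟨Equiv.Perm.sign (Set.powersetCard.permOfDisjoint
    (s := Set.powersetCard.ofCard (s := s) rfl) (t := Set.powersetCard.ofCard (s := t) rfl) h), ?_⟩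
  rw [monomial_eq_basis, monomial_eq_basis, monomial_eq_basis, ← Finset.disjUnion_eq_union s t h]
  exact this

/-! ### Induced gradings and renumbering of generators -/

section InducedGrading

variable {G : Type*} [AddCommGroup G]

theorem monomial_mem_inducedGrading (deg : ℕ → G) (s : Finset ℕ) :
    monomial F s ∈ inducedGrading F deg (∑ i ∈ s, deg i) :=
  Submodule.subset_span ⟨s, rfl, rfl⟩

theorem gen_mem_inducedGrading (deg : ℕ → G) (i : ℕ) :
    gen F i ∈ inducedGrading F deg (deg i) := by
  simpa using monomial_mem_inducedGrading (F := F) deg {i}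

instance gradedMonoid_inducedGrading (deg : ℕ → G) :
    SetLike.GradedMonoid (inducedGrading F deg) where
  one_mem := by simpa using monomial_mem_inducedGrading (F := F) deg ∅
  mul_mem := by
    intro g h x y hx hy
    induction hx using Submodule.span_induction with
    | zero => simp
    | add x x' _ _ hx hx' => rw [add_mul]; exact add_mem hx hx'
    | smul c x _ hx => rw [smul_mul_assoc]; exact Submodule.smul_mem _ _ hx
    | mem x hx =>
      induction hy using Submodule.span_induction with
      | zero => simp
      | add y y' _ _ hy hy' => rw [mul_add]; exact add_mem hy hy'
      | smul c y _ hy => rw [mul_smul_comm]; exact Submodule.smul_mem _ _ hy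
      | mem y hy =>
        obtain ⟨s, rfl, rfl⟩ := hx
        obtain ⟨t, rfl, rfl⟩ := hy
        by_cases hst : Disjoint s t
        · obtain ⟨ε, hε⟩ := monomial_mul_of_disjoint (F := F) hst
          rw [hε, ← Finset.sum_union hst, Units.smul_def]
          exact zsmul_mem (monomial_mem_inducedGrading deg _) _
        · rw [monomial_mul_of_not_disjoint hst]
          exact zero_mem _

theorem inducedGrading_eq_span_image (deg : ℕ → G) (g : G) :
    inducedGrading F deg g =
      Submodule.span F (monomial F '' {s : Finset ℕ | ∑ i ∈ s, deg i = g}) := by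
  rw [inducedGrading]
  congr 1
  ext w
  simp [eq_comm]

theorem isInternal_inducedGrading [DecidableEq G] (deg : ℕ → G) :
    DirectSum.IsInternal (inducedGrading F deg) := by
  rw [DirectSum.isInternal_submodule_iff_iSupIndep_and_iSup_eq_top]
  constructor
  · intro g
    simp only [inducedGrading_eq_span_image, ← Submodule.span_iUnion, ← Set.image_iUnion]
    apply linearIndependent_monomial.disjoint_span_image
    rw [Set.disjoint_left]
    intro s hs hs'
    simp only [Set.mem_iUnion, Set.mem_ofPred_eq, exists_prop] at hs hs'
    obtain ⟨h, hne, hs'⟩ := hs'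
    exact hne (hs'.symm.trans hs)
  · rw [eq_top_iff, ← span_range_monomial, Submodule.span_le]
    rintro _ ⟨s, rfl⟩
    exact Submodule.mem_iSup_of_mem _ (monomial_mem_inducedGrading deg s)

theorem inducedGrading_le_comp {H : Type*} [AddCommGroup H] (φ : G →+ H) (deg : ℕ → G) (g : G) :
    inducedGrading F deg g ≤ inducedGrading F (φ ∘ deg) (φ g) := by
  refine Submodule.span_mono ?_
  rintro w ⟨s, rfl, rfl⟩
  exact ⟨s, by simp, rfl⟩

/-- The endomorphism of the Grassmann algebra that renumbers the generators along `π`. -/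
noncomputable def reindex (F : Type*) [Field F] (π : ℕ → ℕ) : Grassmann F →ₐ[F] Grassmann F :=
  ExteriorAlgebra.map (Finsupp.lmapDomain F F π)

@[simp]
theorem reindex_gen (π : ℕ → ℕ) (i : ℕ) : reindex F π (gen F i) = gen F (π i) := by
  simp [reindex, gen]

theorem reindex_mem_inducedGrading (deg : ℕ → G) (π : ℕ → ℕ) {g : G} {x : Grassmann F}
    (hx : x ∈ inducedGrading F (deg ∘ π) g) : reindex F π x ∈ inducedGrading F deg g := by
  induction hx using Submodule.span_induction with
  | zero => simp
  | add x y _ _ hx hy => rw [map_add]; exact add_mem hx hy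
  | smul c x _ hx => rw [map_smul]; exact Submodule.smul_mem _ _ hx
  | mem x hx =>
    obtain ⟨s, rfl, rfl⟩ := hx
    have := SetLike.list_prod_map_mem_graded (A := inducedGrading F deg) (s.sort (· ≤ ·))
      (deg ∘ π) (fun i => gen F (π i)) fun j _ => gen_mem_inducedGrading deg (π j)
    rw [monomial, map_list_prod, List.map_map]
    convert this using 2
    · rw [← Finset.sum_map_toList]
      exact ((Finset.sort_perm_toList s (· ≤ ·)).map _).sum_eq.symm
    · simp [Function.comp_def]

theorem reindex_reindex_symm (π : ℕ ≃ ℕ) (x : Grassmann F) :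
    reindex F π.symm (reindex F π x) = x := by
  suffices (reindex F π.symm).comp (reindex F π) = AlgHom.id F _ from DFunLike.congr_fun this x
  apply ExteriorAlgebra.hom_ext
  ext i
  simp [reindex]

end InducedGrading

/-! ### Finite support and cancellation of fresh generators -/

section Support

/-- The subalgebra generated by the generators with index in `W`. -/
noncomputable def supportedIn (F : Type*) [Field F] (W : Finset ℕ) : Subalgebra F (Grassmann F) :=
  Algebra.adjoin F (gen F '' W)

theorem gen_mem_supportedIn {W : Finset ℕ} {i : ℕ} (h : i ∈ W) : gen F i ∈ supportedIn F W :=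
  Algebra.subset_adjoin ⟨i, h, rfl⟩

theorem supportedIn_mono {V W : Finset ℕ} (h : V ⊆ W) : supportedIn F V ≤ supportedIn F W :=
  Algebra.adjoin_mono (Set.image_mono h)

theorem exists_mem_supportedIn (x : Grassmann F) : ∃ W, x ∈ supportedIn F W := by
  classical
  induction x using ExteriorAlgebra.induction with
  | algebraMap r => exact ⟨∅, algebraMap_mem _ r⟩
  | ι v =>
    refine ⟨v.support, ?_⟩
    suffices ∑ i ∈ v.support, ExteriorAlgebra.ι F (Finsupp.single i (v i)) ∈
        supportedIn F v.support by
      rwa [← map_sum, ← Finsupp.sum, Finsupp.sum_single] at this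
    refine sum_mem fun i hi => ?_
    rw [← mul_one (v i), ← smul_eq_mul, ← Finsupp.smul_single, map_smul]
    exact Subalgebra.smul_mem _ (gen_mem_supportedIn hi) _
  | mul x y hx hy =>
    obtain ⟨V, hV⟩ := hx
    obtain ⟨W, hW⟩ := hy
    exact ⟨V ∪ W, mul_mem (supportedIn_mono Finset.subset_union_left hV)
      (supportedIn_mono Finset.subset_union_right hW)⟩
  | add x y hx hy =>
    obtain ⟨V, hV⟩ := hx
    obtain ⟨W, hW⟩ := hy
    exact ⟨V ∪ W, add_mem (supportedIn_mono Finset.subset_union_left hV)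
      (supportedIn_mono Finset.subset_union_right hW)⟩

/-- Contraction with the `i`-th coordinate functional is an antiderivation, and it kills every
generator other than the `i`-th. -/
theorem contractRight_eq_zero {W : Finset ℕ} {i : ℕ} (hi : i ∉ W) {x : Grassmann F}
    (hx : x ∈ supportedIn F W) :
    CliffordAlgebra.contractRight (Q := (0 : QuadraticForm F (ℕ →₀ F))) x (Finsupp.lapply i) = 0 := by
  -- Products are built from the right because the contraction rule splits off the last factor.
  have hx' : x ∈ Submodule.span F (Submonoid.closure (gen F '' (W : Set ℕ)) : Set (Grassmann F)) := by
    rw [← Algebra.adjoin_eq_span]; exact hx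
  clear hx
  induction hx' using Submodule.span_induction with
  | zero => simp
  | add x y _ _ hx hy => rw [map_add, LinearMap.add_apply, hx, hy, add_zero]
  | smul c x _ hx => rw [map_smul, LinearMap.smul_apply, hx, smul_zero]
  | mem x hx =>
    induction hx using Submonoid.closure_induction_right with
    | one => exact CliffordAlgebra.contractRight_one ..
    | mul_right x _ y hy ih =>
      obtain ⟨j, hj, rfl⟩ := hy
      have hij : j ≠ i := fun h => hi (h ▸ hj)
      have := CliffordAlgebra.contractRight_mul_ι (Q := (0 : QuadraticForm F (ℕ →₀ F)))
        (d := Finsupp.lapply i) (Finsupp.single j 1) x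
      refine this.trans ?_
      rw [ih]
      simp [hij]

/-- Contracting `x * gen F i` with the `i`-th coordinate returns `x`, since `x` itself contracts to
zero. -/
theorem eq_zero_of_mul_gen {W : Finset ℕ} {i : ℕ} (hi : i ∉ W) {x : Grassmann F}
    (hx : x ∈ supportedIn F W) (h : x * gen F i = 0) : x = 0 := by
  have := CliffordAlgebra.contractRight_mul_ι (Q := (0 : QuadraticForm F (ℕ →₀ F)))
    (d := Finsupp.lapply i) (Finsupp.single i 1) x
  rw [contractRight_eq_zero hi hx] at this
  have h' : x * CliffordAlgebra.ι (0 : QuadraticForm F (ℕ →₀ F)) (Finsupp.single i 1) = 0 := h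
  rw [h'] at this
  simpa using this.symm

theorem eq_zero_of_mul_list_prod {W : Finset ℕ} {l : List ℕ} (hl : l.Nodup)
    (hd : ∀ i ∈ l, i ∉ W) {x : Grassmann F} (hx : x ∈ supportedIn F W)
    (h : x * (l.map (gen F)).prod = 0) : x = 0 := by
  induction l generalizing W x with
  | nil => simpa using h
  | cons i l ih =>
    rw [List.nodup_cons] at hl
    refine eq_zero_of_mul_gen (hd i (by simp)) hx
      (ih (W := insert i W) hl.2 ?_ ?_ (by simpa [mul_assoc] using h))
    · intro j hj
      rw [Finset.mem_insert, not_or]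
      exact ⟨fun e => hl.1 (e ▸ hj), hd j (by simp [hj])⟩
    · exact mul_mem (supportedIn_mono (Finset.subset_insert _ _) hx)
        (gen_mem_supportedIn (Finset.mem_insert_self _ _))

theorem eq_zero_of_mul_monomial {W s : Finset ℕ} (hs : Disjoint s W) {x : Grassmann F}
    (hx : x ∈ supportedIn F W) (h : x * monomial F s = 0) : x = 0 :=
  eq_zero_of_mul_list_prod (Finset.sort_nodup s _)
    (fun _ hi => Finset.disjoint_left.1 hs ((Finset.mem_sort _).1 hi)) hx h

theorem monomial_mem_supportedIn (s : Finset ℕ) : monomial F s ∈ supportedIn F s := by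
  refine list_prod_mem fun x hx => ?_
  obtain ⟨i, hi, rfl⟩ := List.mem_map.1 hx
  exact gen_mem_supportedIn ((Finset.mem_sort _).1 hi)

theorem exists_common_supportedIn {ι : Type*} (s : Finset ι) (c : ι → Grassmann F) :
    ∃ W, ∀ i ∈ s, c i ∈ supportedIn F W := by
  classical
  choose V hV using fun i => exists_mem_supportedIn (c i)
  exact ⟨s.biUnion V, fun i hi => supportedIn_mono (Finset.subset_biUnion_of_mem V hi) (hV i)⟩

end Support

/-! ### Sign rule and centrality of even monomials -/

section Parity

theorem gen_mul_gen (i j : ℕ) : gen F i * gen F j = -(gen F j * gen F i) :=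
  eq_neg_of_add_eq_zero_left (ExteriorAlgebra.ι_add_mul_swap _ _)

theorem gen_mul_list_prod (i : ℕ) (l : List ℕ) :
    gen F i * (l.map (gen F)).prod = (-1) ^ l.length * ((l.map (gen F)).prod * gen F i) := by
  induction l with
  | nil => simp
  | cons j l ih =>
    rw [List.map_cons, List.prod_cons, ← mul_assoc, gen_mul_gen, neg_mul, mul_assoc, ih,
      ← mul_assoc, ((Commute.neg_one_left (gen F j)).pow_left _).eq.symm, List.length_cons, pow_succ]
    noncomm_ring

theorem list_prod_mul_list_prod (l m : List ℕ) :
    (l.map (gen F)).prod * (m.map (gen F)).prod =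
      (-1) ^ (l.length * m.length) * ((m.map (gen F)).prod * (l.map (gen F)).prod) := by
  induction l with
  | nil => simp
  | cons i l ih =>
    rw [List.map_cons, List.prod_cons, mul_assoc, ih, ← mul_assoc,
      ((Commute.neg_one_left (gen F i)).pow_left _).eq.symm, mul_assoc, ← mul_assoc (gen F i),
      gen_mul_list_prod, List.length_cons, add_mul, one_mul, pow_add]
    noncomm_ring

theorem monomial_mul_monomial_comm (s t : Finset ℕ) :
    monomial F s * monomial F t = (-1) ^ (s.card * t.card) * (monomial F t * monomial F s) := by
  simpa [monomial] using list_prod_mul_list_prod (F := F) (s.sort (· ≤ ·)) (t.sort (· ≤ ·))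

theorem commute_monomial {s : Finset ℕ} (hs : Even s.card) (x : Grassmann F) :
    Commute x (monomial F s) := by
  have hx : x ∈ Submodule.span F (Set.range (monomial F)) := by
    rw [span_range_monomial]; trivial
  induction hx using Submodule.span_induction with
  | zero => exact Commute.zero_left _
  | add x y _ _ hx hy => exact hx.add_left hy
  | smul c x _ hx => exact hx.smul_left c
  | mem x hx =>
    obtain ⟨t, rfl⟩ := hx
    have := monomial_mul_monomial_comm (F := F) t s
    rwa [(hs.mul_left _).neg_one_pow, one_mul] at this

end Parity

end Grassmann

/-! ### Substitutions, graded identities and T-ideals -/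

namespace FreeGraded

variable {F : Type*} [Field F]

section Substitution

theorem lift_lift {X Y A : Type*} [Ring A] [Algebra F A] (σ : Y → A) (s : X → FreeAlgebra F Y)
    (f : FreeAlgebra F X) :
    FreeAlgebra.lift F σ (FreeAlgebra.lift F s f) =
      FreeAlgebra.lift F (fun v => FreeAlgebra.lift F σ (s v)) f := by
  suffices (FreeAlgebra.lift F σ).comp (FreeAlgebra.lift F s) =
      FreeAlgebra.lift F (fun v => FreeAlgebra.lift F σ (s v)) from DFunLike.congr_fun this f
  ext v
  simp

theorem lift_congr_of_mem_adjoin {X A : Type*} [Ring A] [Algebra F A] {V : Set X} {σ τ : X → A}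
    (h : ∀ v ∈ V, σ v = τ v) {f : FreeAlgebra F X}
    (hf : f ∈ Algebra.adjoin F (FreeAlgebra.ι F '' V)) :
    FreeAlgebra.lift F σ f = FreeAlgebra.lift F τ f := by
  have : Algebra.adjoin F (FreeAlgebra.ι F '' V) ≤
      AlgHom.equalizer (FreeAlgebra.lift F σ) (FreeAlgebra.lift F τ) := by
    refine Algebra.adjoin_le ?_
    rintro _ ⟨v, hv, rfl⟩
    simpa [AlgHom.mem_equalizer] using h v hv
  exact this hf

theorem lift_mem_adjoin_range {X A : Type*} [Ring A] [Algebra F A] (σ : X → A)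
    (f : FreeAlgebra F X) : FreeAlgebra.lift F σ f ∈ Algebra.adjoin F (Set.range σ) := by
  induction f using FreeAlgebra.induction with
  | grade0 r => rw [AlgHom.commutes]; exact algebraMap_mem _ r
  | grade1 v => rw [FreeAlgebra.lift_ι_apply]; exact Algebra.subset_adjoin ⟨v, rfl⟩
  | mul f g hf hg => rw [map_mul]; exact mul_mem hf hg
  | add f g hf hg => rw [map_add]; exact add_mem hf hg

theorem exists_finset_mem_adjoin {X : Type*} (f : FreeAlgebra F X) :
    ∃ V : Finset X, f ∈ Algebra.adjoin F (FreeAlgebra.ι F '' (V : Set X)) := by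
  classical
  have mono {V W : Finset X} (h : V ⊆ W) : Algebra.adjoin F (FreeAlgebra.ι F '' (V : Set X)) ≤
      Algebra.adjoin F (FreeAlgebra.ι F '' (W : Set X)) :=
    Algebra.adjoin_mono (Set.image_mono (by exact_mod_cast h))
  induction f using FreeAlgebra.induction with
  | grade0 r => exact ⟨∅, algebraMap_mem _ r⟩
  | grade1 v => exact ⟨{v}, Algebra.subset_adjoin ⟨v, by simp, rfl⟩⟩
  | mul f g hf hg =>
    obtain ⟨V, hV⟩ := hf
    obtain ⟨W, hW⟩ := hg
    exact ⟨V ∪ W, mul_mem (mono Finset.subset_union_left hV) (mono Finset.subset_union_right hW)⟩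
  | add f g hf hg =>
    obtain ⟨V, hV⟩ := hf
    obtain ⟨W, hW⟩ := hg
    exact ⟨V ∪ W, add_mem (mono Finset.subset_union_left hV) (mono Finset.subset_union_right hW)⟩

end Substitution

section TIdeal

variable {G A : Type*} [Ring A] [Algebra F A]

/-- The graded identities, as a two-sided ideal. -/
def identityIdeal (𝒜 : G → Submodule F A) : TwoSidedIdeal (FreeGraded F G) :=
  .mk' (identities 𝒜) (fun _ _ => map_zero _)
    (fun hf hg σ hσ => by rw [map_add, hf σ hσ, hg σ hσ, add_zero])
    (fun hf σ hσ => by rw [map_neg, hf σ hσ, neg_zero])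
    (fun hg σ hσ => by rw [map_mul, hg σ hσ, mul_zero])
    (fun hf σ hσ => by rw [map_mul, hf σ hσ, zero_mul])

@[simp]
theorem mem_identityIdeal {𝒜 : G → Submodule F A} {f : FreeGraded F G} :
    f ∈ identityIdeal 𝒜 ↔ f ∈ identities 𝒜 :=
  TwoSidedIdeal.mem_mk' ..

theorem identities_anti {𝒜 ℬ : G → Submodule F A} (h : ∀ g, 𝒜 g ≤ ℬ g) :
    identities ℬ ⊆ identities 𝒜 :=
  fun _ hf σ hσ => hf σ fun i g => h g (hσ i g)

theorem identities_subset_of_embedding {A' : Type*} [Ring A'] [Algebra F A']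
    {𝒜 : G → Submodule F A} {𝒜' : G → Submodule F A'} (θ : A →ₐ[F] A')
    (hθ : Function.Injective θ) (h : ∀ g, ∀ a ∈ 𝒜 g, θ a ∈ 𝒜' g) :
    identities 𝒜' ⊆ identities 𝒜 := by
  intro f hf σ hσ
  apply hθ
  rw [map_zero, ← hf (θ ∘ σ) fun i g => h g _ (hσ i g)]
  suffices θ.comp (FreeAlgebra.lift F σ) = FreeAlgebra.lift F (θ ∘ σ) from
    DFunLike.congr_fun this f
  ext v
  simp

variable [AddCommMonoid G]

theorem lift_mem_of_mem_component {𝒜 : G → Submodule F A} [SetLike.GradedMonoid 𝒜]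
    {σ : ℕ × G → A} (hσ : ∀ i g, σ (i, g) ∈ 𝒜 g) {g : G} {p : FreeGraded F G}
    (hp : p ∈ component F g) : FreeAlgebra.lift F σ p ∈ 𝒜 g := by
  induction hp using Submodule.span_induction with
  | zero => simp
  | add p q _ _ hp hq => rw [map_add]; exact add_mem hp hq
  | smul c p _ hp => rw [map_smul]; exact Submodule.smul_mem _ _ hp
  | mem p hp =>
    obtain ⟨l, rfl, rfl⟩ := hp
    rw [map_list_prod, List.map_map]
    refine SetLike.list_prod_map_mem_graded l _ _ fun v _ => ?_
    simpa using hσ v.1 v.2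

theorem x_mem_component (i : ℕ) (g : G) : x F i g ∈ component F g :=
  Submodule.subset_span ⟨[(i, g)], by simp, by simp [x]⟩

instance gradedMonoid_component : SetLike.GradedMonoid (component F (G := G)) where
  one_mem := Submodule.subset_span ⟨[], by simp, by simp⟩
  mul_mem := by
    intro g h p q hp hq
    induction hp using Submodule.span_induction with
    | zero => simp
    | add p p' _ _ hp hp' => rw [add_mul]; exact add_mem hp hp'
    | smul c p _ hp => rw [smul_mul_assoc]; exact Submodule.smul_mem _ _ hp
    | mem p hp =>
      induction hq using Submodule.span_induction with
      | zero => simp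
      | add q q' _ _ hq hq' => rw [mul_add]; exact add_mem hq hq'
      | smul c q _ hq => rw [mul_smul_comm]; exact Submodule.smul_mem _ _ hq
      | mem q hq =>
        obtain ⟨l, rfl, rfl⟩ := hp
        obtain ⟨m, rfl, rfl⟩ := hq
        exact Submodule.subset_span ⟨l ++ m, by simp, by simp⟩

theorem isGradedEnd_lift {s : ℕ × G → FreeGraded F G} (hs : ∀ i g, s (i, g) ∈ component F g) :
    IsGradedEnd (FreeAlgebra.lift F s) :=
  fun _ _ hp => lift_mem_of_mem_component hs hp

theorem isTIdeal_identityIdeal (𝒜 : G → Submodule F A) [SetLike.GradedMonoid 𝒜] :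
    IsTIdeal (identityIdeal 𝒜) := by
  intro φ hφ f hf
  rw [mem_identityIdeal] at hf ⊢
  intro σ hσ
  have hφ' : φ = FreeAlgebra.lift F fun v => φ (FreeAlgebra.ι F v) := by ext v; simp
  rw [hφ', lift_lift]
  exact hf _ fun i g => lift_mem_of_mem_component hσ (hφ g _ (x_mem_component i g))

theorem subset_tIdealSpan (S : Set (FreeGraded F G)) : S ⊆ tIdealSpan S := by
  intro f hf
  rw [SetLike.mem_coe, tIdealSpan, TwoSidedIdeal.mem_sInf]
  exact fun I hI => hI.2 hf

theorem tIdealSpan_subset_identities {𝒜 : G → Submodule F A} [SetLike.GradedMonoid 𝒜]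
    {S : Set (FreeGraded F G)} (hS : S ⊆ identities 𝒜) :
    (tIdealSpan S : Set (FreeGraded F G)) ⊆ identities 𝒜 := by
  intro f hf
  rw [SetLike.mem_coe, tIdealSpan, TwoSidedIdeal.mem_sInf] at hf
  exact mem_identityIdeal.1 (hf (identityIdeal 𝒜)
    ⟨isTIdeal_identityIdeal 𝒜, fun g hg => mem_identityIdeal.2 (hS hg)⟩)

end TIdeal

/-! ### Identities pulled back from `ZMod d` to `ℤ` -/

section Coarsening

variable {A : Type*} [Ring A] [Algebra F A] {d : ℕ}

/-- The pulled-back family repeats each component, so it is not a direct sum decomposition;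
multiplicativity is all that the T-ideal property of its identities needs. -/
instance gradedMonoid_intCast (𝒞 : ZMod d → Submodule F A) [SetLike.GradedMonoid 𝒞] :
    SetLike.GradedMonoid fun g : ℤ => 𝒞 g where
  one_mem := by simpa using SetLike.GradedOne.one_mem (A := 𝒞)
  mul_mem := fun _ _ _ _ hx hy => by
    simpa using SetLike.GradedMul.mul_mem (A := 𝒞) hx hy

theorem mem_identities_of_proj_mem {𝒞 : ZMod d → Submodule F A} {f : FreeGraded F ℤ}
    (hf : HasDistinctSubscripts f) (h : proj F d f ∈ identities 𝒞) :
    f ∈ identities fun g : ℤ => 𝒞 g := by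
  obtain ⟨g, hg⟩ := hf
  intro σ hσ
  -- As the subscripts of `f` are distinct, a subscript `i` recalls its integer degree `g i`. So `σ`
  -- factors through the variables with degrees mod `d`; the variables that do not occur get the
  -- value 0.
  rw [← h (fun p => if (g p.1 : ZMod d) = p.2 then σ (p.1, g p.1) else 0) ?_, proj, lift_lift]
  · have hg' : f ∈ Algebra.adjoin F (FreeAlgebra.ι F '' Set.range fun i => (i, g i)) := by
      rw [← Set.range_comp]; exact hg
    refine lift_congr_of_mem_adjoin ?_ hg'
    rintro _ ⟨i, rfl⟩
    simp [x]
  · intro i r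
    dsimp only
    split_ifs with hr
    · rw [← hr]; exact hσ i (g i)
    · exact zero_mem _

theorem tIdealSpan_proj_eq_identities (𝒞 : ZMod d → Submodule F A) [SetLike.GradedMonoid 𝒞] :
    (tIdealSpan {f : FreeGraded F ℤ | HasDistinctSubscripts f ∧ proj F d f ∈ identities 𝒞} :
      Set (FreeGraded F ℤ)) = identities fun g : ℤ => 𝒞 g := by
  apply subset_antisymm
  · exact tIdealSpan_subset_identities fun f hf => mem_identities_of_proj_mem hf.1 hf.2
  · intro f hf
    -- Encoding subscript and degree together in a new subscript makes the subscripts of `φ f`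
    -- distinct. The graded endomorphism `ψ` undoes this, so `f` lies in the T-ideal as soon as `φ
    -- f` does.
    let e : ℕ × ℤ ≃ ℕ := Denumerable.eqv (ℕ × ℤ)
    let φ : FreeGraded F ℤ →ₐ[F] FreeGraded F ℤ := FreeAlgebra.lift F fun p => x F (e p) p.2
    let ψ : FreeGraded F ℤ →ₐ[F] FreeGraded F ℤ :=
      FreeAlgebra.lift F fun p => x F (e.symm p.1).1 p.2
    have hφψ : ψ (φ f) = f := by
      suffices ψ.comp φ = AlgHom.id F _ from DFunLike.congr_fun this f
      ext v
      simp [φ, ψ, x]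
    rw [← hφψ]
    refine isTIdeal_tIdealSpan _ ψ (isGradedEnd_lift fun i g => x_mem_component _ _) _
      (subset_tIdealSpan _ ⟨⟨fun n => (e.symm n).2, ?_⟩, ?_⟩)
    · refine Algebra.adjoin_mono ?_ (lift_mem_adjoin_range _ f)
      rintro _ ⟨p, rfl⟩
      exact ⟨e p, by simp⟩
    · intro τ hτ
      rw [proj, lift_lift, lift_lift]
      refine hf _ fun i g => ?_
      simpa [x] using hτ _ _

end Coarsening

end FreeGraded

/-! ### Powers of sums of central square-zero elements -/

section CentralSquareZero

variable {R : Type*} [Ring R]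

theorem add_pow_succ_of_mul_self_eq_zero {a w : R} (h : Commute a w) (hw : w * w = 0) (j : ℕ) :
    (a + w) ^ (j + 1) = a ^ (j + 1) + (j + 1) • (a ^ j * w) := by
  induction j with
  | zero => simp
  | succ j ih =>
    have h1 : a ^ j * w * a = a ^ (j + 1) * w := by
      rw [mul_assoc, ← h.eq, ← mul_assoc, pow_succ]
    have h2 : a ^ j * w * w = 0 := by rw [mul_assoc, hw, mul_zero]
    rw [pow_succ, ih, add_mul, mul_add, smul_mul_assoc, mul_add, h1, h2, add_zero, ← pow_succ,
      add_assoc, succ_nsmul _ (j + 1), add_comm ((j + 1) • _)]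

theorem sum_range_pow_eq_zero {z : ℕ → R} (hc : ∀ i, ∀ y, Commute y (z i))
    (hz : ∀ i, z i * z i = 0) {n j : ℕ} (hj : n < j) : (∑ t ∈ Finset.range n, z t) ^ j = 0 := by
  induction n generalizing j with
  | zero => simp [hj.ne']
  | succ n ih =>
    obtain ⟨j, rfl⟩ := Nat.exists_eq_add_one.2 (Nat.zero_lt_of_lt hj)
    rw [Finset.sum_range_succ, add_pow_succ_of_mul_self_eq_zero (hc n _) (hz n),
      ih (by lia), ih (by lia), zero_mul, smul_zero, add_zero]

theorem sum_range_pow_self {z : ℕ → R} (hc : ∀ i, ∀ y, Commute y (z i))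
    (hz : ∀ i, z i * z i = 0) (n : ℕ) :
    (∑ t ∈ Finset.range n, z t) ^ n = n.factorial • ((List.range n).map z).prod := by
  induction n with
  | zero => simp
  | succ n ih =>
    rw [Finset.sum_range_succ, add_pow_succ_of_mul_self_eq_zero (hc n _) (hz n),
      sum_range_pow_eq_zero hc hz n.lt_succ_self, ih, zero_add, List.range_succ, List.map_append,
      List.prod_append, smul_mul_assoc, smul_smul, Nat.factorial_succ]
    simp

end CentralSquareZero

/-! ### Polynomials vanishing on fresh even elements -/

namespace Grassmann

variable {F : Type*} [Field F]

theorem eq_zero_of_mul_prod_monomial {W : Finset ℕ} {s : ℕ → Finset ℕ}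
    (hW : ∀ n, Disjoint (s n) W) (hs : ∀ m n, m < n → Disjoint (s m) (s n)) {n : ℕ}
    {c : Grassmann F} (hc : c ∈ supportedIn F W)
    (h : c * ((List.range n).map fun t => monomial F (s t)).prod = 0) : c = 0 := by
  classical
  have key : ∀ n, ((List.range n).map fun t => monomial F (s t)).prod ∈
      supportedIn F ((Finset.range n).biUnion s) := by
    intro n
    refine list_prod_mem fun x hx => ?_
    obtain ⟨t, ht, rfl⟩ := List.mem_map.1 hx
    exact supportedIn_mono (Finset.subset_biUnion_of_mem s (by simpa using ht))
      (monomial_mem_supportedIn _)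
  induction n with
  | zero => simpa using h
  | succ n ih =>
    rw [List.range_succ, List.map_append, List.prod_append, ← mul_assoc] at h
    refine ih (eq_zero_of_mul_monomial (W := W ∪ (Finset.range n).biUnion s) (s := s n) ?_
      (mul_mem (supportedIn_mono Finset.subset_union_left hc)
        (supportedIn_mono Finset.subset_union_right (key n))) (by simpa using h))
    rw [Finset.disjoint_union_right, Finset.disjoint_biUnion_right]
    exact ⟨hW n, fun m hm => (hs m n (by simpa using hm)).symm⟩

/-- The span of the monomials with non-empty support of even size satisfying `P`. -/
noncomputable def evenSpan (F : Type*) [Field F] (P : Finset ℕ → Prop) :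
    Submodule F (Grassmann F) :=
  Submodule.span F {w | ∃ s : Finset ℕ, s.Nonempty ∧ Even s.card ∧ P s ∧ w = monomial F s}

theorem commute_of_mem_evenSpan {P : Finset ℕ → Prop} {z : Grassmann F} (hz : z ∈ evenSpan F P)
    (y : Grassmann F) : Commute y z := by
  induction hz using Submodule.span_induction with
  | zero => exact Commute.zero_right _
  | add x x' _ _ hx hx' => exact hx.add_right hx'
  | smul c x _ hx => exact hx.smul_right c
  | mem x hx =>
    obtain ⟨s, -, hs, -, rfl⟩ := hx
    exact commute_monomial hs y

/-- `P` holds for non-empty sets of even size away from any finite set of generators. -/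
def HasFreeEven (P : Finset ℕ → Prop) : Prop :=
  ∀ W : Finset ℕ, ∃ s : Finset ℕ, Disjoint s W ∧ s.Nonempty ∧ Even s.card ∧ P s

theorem HasFreeEven.exists_seq {P : Finset ℕ → Prop} (hP : HasFreeEven P) (W : Finset ℕ) :
    ∃ s : ℕ → Finset ℕ, (∀ n, Disjoint (s n) W ∧ (s n).Nonempty ∧ Even (s n).card ∧ P (s n)) ∧
      ∀ m n, m < n → Disjoint (s m) (s n) := by
  classical
  refine exists_seq_of_forall_finset_exists
    (fun s : Finset ℕ => Disjoint s W ∧ s.Nonempty ∧ Even s.card ∧ P s) _ fun T _ => ?_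
  obtain ⟨t, ht, htP⟩ := hP (W ∪ T.biUnion id)
  rw [Finset.disjoint_union_right, Finset.disjoint_biUnion_right] at ht
  exact ⟨t, ⟨ht.1, htP⟩, fun u hu => (ht.2 u hu).symm⟩

/-- Substitute a sum of `d` disjoint even monomials that avoid the supports of all coefficients.
Coefficients below `d` vanish by induction and powers above `d` are zero, which leaves `d!` times
the `d`-th coefficient times a fresh product; that product cancels. -/
theorem polynomial_eq_zero_of_eval_evenSpan [CharZero F] {P : Finset ℕ → Prop}
    (hP : HasFreeEven P) (p : Polynomial (Grassmann F))
    (h : ∀ z ∈ evenSpan F P, p.eval z = 0) : p = 0 := by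
  obtain ⟨W, hW⟩ := exists_common_supportedIn p.support p.coeff
  obtain ⟨s, hs, hd⟩ := hP.exists_seq W
  set z : ℕ → Grassmann F := fun n => monomial F (s n) with hz
  have hzc : ∀ i y, Commute y (z i) := fun i y => commute_monomial (hs i).2.2.1 y
  have hzz : ∀ i, z i * z i = 0 := fun i =>
    monomial_mul_of_not_disjoint (by
      rw [disjoint_self]; exact (hs i).2.1.ne_empty)
  have hmem : ∀ n, ∑ t ∈ Finset.range n, z t ∈ evenSpan F P := fun n =>
    sum_mem fun t _ => Submodule.subset_span ⟨s t, (hs t).2.1, (hs t).2.2.1, (hs t).2.2.2, rfl⟩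
  ext d
  rw [Polynomial.coeff_zero]
  induction d using Nat.strong_induction_on with
  | _ d ih =>
    by_contra hne
    have hds : d ∈ p.support := Polynomial.mem_support_iff.2 hne
    have h0 := h _ (hmem d)
    rw [Polynomial.eval_eq_sum, Polynomial.sum, Finset.sum_eq_single_of_mem d hds] at h0
    · rw [sum_range_pow_self hzc hzz, mul_smul_comm, ← Nat.cast_smul_eq_nsmul F,
        smul_eq_zero_iff_right (by exact_mod_cast d.factorial_ne_zero)] at h0
      exact hne (eq_zero_of_mul_prod_monomial (fun n => (hs n).1) hd (hW d hds) h0)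
    · intro j _ hj
      rcases lt_or_gt_of_ne hj with hj | hj
      · rw [ih j hj, zero_mul]
      · rw [sum_range_pow_eq_zero hzc hzz hj, mul_zero]

end Grassmann

/-! ### Transfer of identities along even monomials -/

namespace FreeGraded

open Grassmann

/-- Over a noncommutative ring, evaluation is multiplicative here because `z` is central. -/
theorem eval_lift {F X A : Type*} [Field F] [Ring A] [Algebra F A] {z : A}
    (hz : ∀ y, Commute y z) (S : X → Polynomial A) (f : FreeAlgebra F X) :
    (FreeAlgebra.lift F S f).eval z = FreeAlgebra.lift F (fun v => (S v).eval z) f := by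
  induction f using FreeAlgebra.induction with
  | grade0 r => simp [Polynomial.algebraMap_apply]
  | grade1 v => simp
  | add f g hf hg => simp [hf, hg]
  | mul f g hf hg =>
    rw [map_mul, map_mul, Polynomial.eval, Polynomial.eval₂_mul_noncomm _ _ fun k => hz _,
      ← Polynomial.eval, ← Polynomial.eval, hf, hg]

variable {F : Type*} [Field F]

/-- A family of subspaces whose monomials can be moved into `𝒜` by multiplication with fresh even
monomials satisfies all the graded identities of `𝒜`. -/
theorem identities_subset_of_hasFreeEven [CharZero F] {G : Type*}
    {𝒜 ℬ : G → Submodule F (Grassmann F)} {M : G → Set (Grassmann F)}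
    (hM : ∀ g, ℬ g ≤ Submodule.span F (M g))
    (h : ∀ g, ∀ m ∈ M g, HasFreeEven fun s => m * monomial F s ∈ 𝒜 g) :
    identities 𝒜 ⊆ identities ℬ := by
  classical
  intro f hf σ hσ
  -- `Φ` consists of the offsets that may be added to any substitution admissible for `𝒜` without
  -- spoiling the vanishing of `f`. Quantifying over `τ` lets monomials be added one at a time,
  -- starting from the offset 0.
  let Φ : Set (ℕ × G → Grassmann F) :=
    {ρ | ∀ τ : ℕ × G → Grassmann F, (∀ i g, τ (i, g) ∈ 𝒜 g) → FreeAlgebra.lift F (ρ + τ) f = 0}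
  have single_mem : ∀ v : ℕ × G, ∀ m ∈ M v.2, ∀ c : F, ∀ ρ ∈ Φ, ρ + Pi.single v (c • m) ∈ Φ := by
    intro v m hm c ρ hρ τ hτ
    let S : ℕ × G → Polynomial (Grassmann F) := fun u =>
      Polynomial.C (ρ u + τ u) + Polynomial.C ((Pi.single v (c • m) : ℕ × G → Grassmann F) u) *
        Polynomial.X
    have hS : ∀ z, ∀ u, (S u).eval z =
        ρ u + τ u + (Pi.single v (c • m) : ℕ × G → Grassmann F) u * z := by
      intro z u
      simp [S]
    have hp : FreeAlgebra.lift F S f = 0 := by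
      refine polynomial_eq_zero_of_eval_evenSpan (h v.2 m hm) _ fun z hz => ?_
      rw [eval_lift (commute_of_mem_evenSpan hz)]
      have hmz : m * z ∈ 𝒜 v.2 := by
        induction hz using Submodule.span_induction with
        | zero => simp
        | add x y _ _ hx hy => rw [mul_add]; exact add_mem hx hy
        | smul r x _ hx => rw [mul_smul_comm]; exact Submodule.smul_mem _ _ hx
        | mem x hx =>
          obtain ⟨s, -, -, hs, rfl⟩ := hx
          exact hs
      rw [← hρ (τ + Pi.single v (c • (m * z))) ?_]
      · congr 1
        congr 1
        ext u
        rw [hS]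
        by_cases hu : u = v
        · subst hu; simp [add_assoc]
        · simp [hu]
      · intro i g
        by_cases hu : (i, g) = v
        · subst hu
          simpa using add_mem (hτ i g) (Submodule.smul_mem _ c hmz)
        · simpa [hu] using hτ i g
    -- The polynomial is identically zero, so it may be evaluated at the central element 1, which
    -- turns `m * z` into `m`.
    have h1 : (FreeAlgebra.lift F S f).eval 1 = 0 := by rw [hp, Polynomial.eval_zero]
    rw [eval_lift Commute.one_right] at h1
    rw [← h1]
    congr 1
    congr 1
    ext u
    rw [hS, mul_one, Pi.add_apply, Pi.add_apply, add_right_comm]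
  have single_mem' : ∀ v : ℕ × G, ∀ y ∈ ℬ v.2, ∀ ρ ∈ Φ, ρ + Pi.single v y ∈ Φ := by
    intro v y hy ρ hρ
    suffices ∀ c : F, ∀ ρ ∈ Φ, ρ + Pi.single v (c • y) ∈ Φ by simpa using this 1 ρ hρ
    clear hρ ρ
    replace hy := hM _ hy
    induction hy using Submodule.span_induction with
    | zero => simp
    | add y y' _ _ ih ih' =>
      intro c ρ hρ
      rw [smul_add, Pi.single_add, ← add_assoc]
      exact ih' c _ (ih c ρ hρ)
    | smul r y _ ih => intro c ρ hρ; rw [smul_smul]; exact ih _ ρ hρ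
    | mem m hm => exact single_mem v m hm
  -- Only the finitely many variables in `f` matter, so finitely many changes of the offset reach
  -- `σ`.
  obtain ⟨V, hV⟩ := exists_finset_mem_adjoin f
  have hΦ : ∀ U : Finset (ℕ × G), (∑ v ∈ U, Pi.single v (σ v)) ∈ Φ := by
    intro U
    induction U using Finset.induction_on with
    | empty => intro τ hτ; simpa using hf τ hτ
    | insert v U hv ih =>
      rw [Finset.sum_insert hv, add_comm]
      exact single_mem' v _ (hσ _ _) _ ih
  rw [← hΦ V 0 fun i g => zero_mem _]
  refine lift_congr_of_mem_adjoin (fun v hv => ?_) hV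
  rw [add_zero, Finset.sum_apply, Finset.sum_eq_single_of_mem v hv]
  · simp
  · intro u _ hu
    simp [hu.symm]

end FreeGraded

open Grassmann FreeGraded

/-! ### Two-centrality and reduction of degrees mod 2 -/

namespace Grassmann

variable {F : Type*} [Field F]

/-- Every even integer is the degree of a non-empty monomial of even length whose support avoids
a given finite set of generators. -/
def HasEvenMonomials (deg : ℕ → ℤ) : Prop :=
  ∀ r : ℤ, Even r → HasFreeEven fun s => ∑ i ∈ s, deg i = r

theorem isIntCentralGrading_two {deg : ℕ → ℤ} (hdeg : HasEvenMonomials deg)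
    (hsupp : ∀ r : ℤ, ∃ s : Finset ℕ, ∑ i ∈ s, deg i = r) :
    IsIntCentralGrading 2 (inducedGrading F deg) where
  isInternal := isInternal_inducedGrading deg
  gradedMonoid := inferInstance
  homogeneous i := ⟨deg i, gen_mem_inducedGrading deg i⟩
  full_support r := by
    obtain ⟨s, rfl⟩ := hsupp r
    exact fun h => monomial_ne_zero (F := F) s
      ((Submodule.eq_bot_iff _).1 h _ (monomial_mem_inducedGrading deg s))
  central r hr := by
    obtain ⟨t, rfl⟩ := AddSubgroup.mem_zmultiples_iff.1 hr
    obtain ⟨s, hs, hd⟩ := (hdeg (t • 2) (by simp)).exists_seq ∅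
    have hd' : Pairwise (Function.onFun Disjoint s) := (pairwise_disjoint_on s).2 fun m n h => hd m n h
    refine ⟨Set.range s, Set.infinite_range_of_injective fun m n hmn => ?_, ?_, ?_⟩
    · by_contra hne
      have := hd' hne
      rw [Function.onFun, hmn, disjoint_self] at this
      exact (hs n).2.1.ne_empty this
    · rintro _ ⟨m, rfl⟩ _ ⟨n, rfl⟩ hne
      exact hd' fun h => hne (h ▸ rfl)
    · rintro _ ⟨n, rfl⟩
      refine ⟨(hs n).2.2.1, ?_⟩
      rw [← (hs n).2.2.2]
      exact monomial_mem_inducedGrading deg _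

theorem identities_inducedGrading_eq_mod_two [CharZero F] {deg : ℕ → ℤ}
    (hdeg : HasEvenMonomials deg) :
    identities (inducedGrading F deg) =
      identities fun g : ℤ => inducedGrading F (fun i => (deg i : ZMod 2)) (g : ZMod 2) := by
  apply subset_antisymm
  · refine identities_subset_of_hasFreeEven (M := fun g : ℤ =>
      {w | ∃ s : Finset ℕ, ∑ i ∈ s, (deg i : ZMod 2) = g ∧ w = monomial F s})
      (fun g => le_rfl) ?_
    rintro g _ ⟨t, ht, rfl⟩ W
    -- The degree missing from the monomial on `t` is even, so a fresh even monomial can supply it.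
    have heven : Even (g - ∑ i ∈ t, deg i) := by
      rw [← ZMod.intCast_eq_zero_iff_even]
      push_cast
      rw [ht, sub_self]
    obtain ⟨s, hsW, hs0, hs2, hs⟩ := hdeg _ heven W
    refine ⟨s, hsW, hs0, hs2, ?_⟩
    have := SetLike.GradedMul.mul_mem (A := inducedGrading F deg)
      (monomial_mem_inducedGrading (F := F) deg t) (monomial_mem_inducedGrading deg s)
    rwa [hs, add_sub_cancel] at this
  · exact identities_anti fun g => inducedGrading_le_comp (Int.castAddHom (ZMod 2)) deg g

theorem identities_inducedGrading_comp_subset {G : Type*} [AddCommGroup G] {ι : Type*} (f : ι → G)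
    (deg : ℕ → G) (π : ℕ ≃ ℕ) :
    identities (fun g => inducedGrading F deg (f g)) ⊆
      identities fun g => inducedGrading F (deg ∘ π) (f g) :=
  identities_subset_of_embedding (reindex F π)
    (Function.LeftInverse.injective (reindex_reindex_symm π))
    fun _ _ ha => reindex_mem_inducedGrading deg π ha

theorem identities_inducedGrading_comp {G : Type*} [AddCommGroup G] {ι : Type*} (f : ι → G)
    (deg : ℕ → G) (π : ℕ ≃ ℕ) :
    identities (fun g => inducedGrading F (deg ∘ π) (f g)) =
      identities fun g => inducedGrading F deg (f g) := by
  apply subset_antisymm _ (identities_inducedGrading_comp_subset f deg π)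
  have := identities_inducedGrading_comp_subset (F := F) f (deg ∘ π) π.symm
  rwa [Function.comp_assoc, Equiv.self_comp_symm, Function.comp_id] at this

end Grassmann

/-! ### Classification of the coarsened gradings by counting -/

theorem Set.nonempty_equiv_of_encard_eq {α β : Type*} [Countable α] [Countable β] {s : Set α}
    {t : Set β} (h : s.encard = t.encard) : Nonempty (s ≃ t) := by
  by_cases hs : s.Finite
  · have ht : t.Finite := by rwa [← Set.encard_lt_top_iff, ← h, Set.encard_lt_top_iff]
    have := hs.to_subtype
    have := ht.to_subtype
    refine Finite.card_eq.1 ?_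
    rw [Nat.card_coe_set_eq, Nat.card_coe_set_eq, Set.ncard, Set.ncard, h]
  · have ht : ¬ t.Finite := by rwa [← Set.encard_lt_top_iff, ← h, Set.encard_lt_top_iff]
    have := Set.infinite_coe_iff.2 hs
    have := Set.infinite_coe_iff.2 ht
    exact nonempty_equiv_of_countable

/-- Bijections between corresponding fibres glue to a bijection of the whole sets. -/
theorem exists_equiv_comp_eq {α β γ : Type*} [Countable α] [Countable β] {f : α → γ} {g : β → γ}
    (h : ∀ c, {a | f a = c}.encard = {b | g b = c}.encard) : ∃ π : α ≃ β, g ∘ π = f := by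
  have e := fun c => (Set.nonempty_equiv_of_encard_eq (h c)).some
  refine ⟨(Equiv.sigmaFiberEquiv f).symm.trans
    ((Equiv.sigmaCongrRight e).trans (Equiv.sigmaFiberEquiv g)), ?_⟩
  ext a
  exact (e (f a) ⟨a, rfl⟩).2

namespace Grassmann

variable {F : Type*} [Field F]

theorem identities_eq_of_encard_eq {G : Type*} [AddCommGroup G] {ι : Type*} (f : ι → G)
    {deg deg' : ℕ → G} (h : ∀ c, {i | deg i = c}.encard = {i | deg' i = c}.encard) :
    identities (fun g => inducedGrading F deg (f g)) =
      identities fun g => inducedGrading F deg' (f g) := by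
  obtain ⟨π, rfl⟩ := exists_equiv_comp_eq h
  exact identities_inducedGrading_comp f deg' π

instance (k : ℕ) : SetLike.GradedMonoid (gradingK F k) :=
  inferInstanceAs (SetLike.GradedMonoid (inducedGrading F _))

instance : SetLike.GradedMonoid (gradingInf F) :=
  inferInstanceAs (SetLike.GradedMonoid (inducedGrading F _))

theorem setOf_intCast_zmod_two_eq_zero (deg : ℕ → ℤ) :
    {i | (deg i : ZMod 2) = 0} = {i | Even (deg i)} := by
  simp [ZMod.intCast_eq_zero_iff_even]

theorem setOf_intCast_zmod_two_eq_one (deg : ℕ → ℤ) :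
    {i | (deg i : ZMod 2) = 1} = {i | Odd (deg i)} := by
  simp [ZMod.intCast_eq_one_iff_odd]

theorem isGeneratedBy_var101 [CharZero F] {deg : ℕ → ℤ} (hdeg : HasEvenMonomials deg) {k : ℕ}
    (h0 : {i | Even (deg i)}.encard = k) (h1 : {i | Odd (deg i)}.Infinite) :
    (GradedVariety.var101 F k).IsGeneratedBy (inducedGrading F deg) := by
  rw [GradedVariety.IsGeneratedBy, identities_inducedGrading_eq_mod_two hdeg]
  refine (tIdealSpan_proj_eq_identities (gradingK F k)).trans ?_
  refine identities_eq_of_encard_eq (Int.cast : ℤ → ZMod 2) fun c => ?_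
  obtain rfl | rfl : c = 0 ∨ c = 1 := by revert c; decide
  · rw [setOf_intCast_zmod_two_eq_zero, h0,
      ← Finset.card_range k, ← Set.encard_coe_eq_coe_finsetCard]
    congr 1
    ext i
    simp
  · rw [setOf_intCast_zmod_two_eq_one, h1.encard_eq, Set.encard_eq_top_iff]
    refine (Set.Ici_infinite k).mono fun i hi => ?_
    simpa using hi

theorem isGeneratedBy_var102 [CharZero F] {deg : ℕ → ℤ} (hdeg : HasEvenMonomials deg)
    (h0 : {i | Even (deg i)}.Infinite) (h1 : {i | Odd (deg i)}.Infinite) :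
    (GradedVariety.var102 F).IsGeneratedBy (inducedGrading F deg) := by
  rw [GradedVariety.IsGeneratedBy, identities_inducedGrading_eq_mod_two hdeg]
  refine (tIdealSpan_proj_eq_identities (gradingInf F)).trans ?_
  refine identities_eq_of_encard_eq (Int.cast : ℤ → ZMod 2) fun c => ?_
  obtain rfl | rfl : c = 0 ∨ c = 1 := by revert c; decide
  · rw [setOf_intCast_zmod_two_eq_zero, h0.encard_eq, Set.encard_eq_top_iff]
    refine Set.infinite_of_injective_forall_mem (f := fun n : ℕ => 2 * n + 1)
      (fun m n h => by simpa using h) fun n => ?_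
    have : Even (2 * n + 1 + 1) := ⟨n + 1, by ring⟩
    simp [this]
  · rw [setOf_intCast_zmod_two_eq_one, h1.encard_eq, Set.encard_eq_top_iff]
    refine Set.infinite_of_injective_forall_mem (f := fun n : ℕ => 2 * n)
      (fun m n h => by simpa using h) fun n => ?_
    simp

end Grassmann

/-! ### The canonical parity grading -/

namespace Grassmann

variable {F : Type*} [Field F]

/-- The even part (`r = 0`) and the odd part (`r = 1`) of the Grassmann algebra. -/
noncomputable abbrev parityGrading (F : Type*) [Field F] : ZMod 2 → Submodule F (Grassmann F) :=
  inducedGrading F fun _ => 1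

theorem monomial_mem_parityGrading (s : Finset ℕ) :
    monomial F s ∈ parityGrading F (s.card : ZMod 2) := by
  simpa using monomial_mem_inducedGrading (F := F) (fun _ => (1 : ZMod 2)) s

theorem commute_of_mem_parityGrading_zero {x : Grassmann F} (hx : x ∈ parityGrading F 0)
    (y : Grassmann F) : Commute y x := by
  induction hx using Submodule.span_induction with
  | zero => exact Commute.zero_right _
  | add x x' _ _ hx hx' => exact hx.add_right hx'
  | smul c x _ hx => exact hx.smul_right c
  | mem x hx =>
    obtain ⟨s, hs, rfl⟩ := hx
    refine commute_monomial ?_ y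
    simpa [ZMod.natCast_eq_zero_iff_even] using hs

theorem mul_add_mul_eq_zero_of_mem_parityGrading_one {x y : Grassmann F}
    (hx : x ∈ parityGrading F 1) (hy : y ∈ parityGrading F 1) : x * y + y * x = 0 := by
  induction hx using Submodule.span_induction with
  | zero => simp
  | add x x' _ _ hx hx' =>
    rw [add_mul, mul_add, add_add_add_comm, hx, hx', add_zero]
  | smul c x _ hx => rw [smul_mul_assoc, mul_smul_comm, ← smul_add, hx, smul_zero]
  | mem x hx =>
    induction hy using Submodule.span_induction with
    | zero => simp
    | add y y' _ _ hy hy' =>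
      rw [add_mul, mul_add, add_add_add_comm, hy, hy', add_zero]
    | smul c y _ hy => rw [smul_mul_assoc, mul_smul_comm, ← smul_add, hy, smul_zero]
    | mem y hy =>
      obtain ⟨s, hs, rfl⟩ := hx
      obtain ⟨t, ht, rfl⟩ := hy
      have hs' : Odd s.card := by simpa [ZMod.natCast_eq_one_iff_odd] using hs
      have ht' : Odd t.card := by simpa [ZMod.natCast_eq_one_iff_odd] using ht
      rw [monomial_mul_monomial_comm, (hs'.mul ht').neg_one_pow, neg_one_mul, neg_add_cancel]

end Grassmann

/-! ### Generators for the identities of the parity grading -/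

namespace GradedVariety

variable {F : Type*} [Field F]

theorem varCan_subset_identities :
    ((varCan F).tIdeal : Set (FreeGraded F ℤ)) ⊆
      identities fun g : ℤ => parityGrading F (g : ZMod 2) := by
  refine tIdealSpan_subset_identities ?_
  rintro f (⟨g, h, hgh, rfl⟩ | ⟨g, h, ⟨hg, hh⟩, rfl⟩) σ hσ
  · have h1 : σ (1, g) ∈ parityGrading F (g : ZMod 2) := hσ 1 g
    have h2 : σ (2, h) ∈ parityGrading F (h : ZMod 2) := hσ 2 h
    simp only [x, map_sub, map_mul, FreeAlgebra.lift_ι_apply, sub_eq_zero]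
    rcases hgh with hg | hh
    · rw [ZMod.intCast_eq_zero_iff_even.2 hg] at h1
      exact (commute_of_mem_parityGrading_zero h1 _).eq.symm
    · rw [ZMod.intCast_eq_zero_iff_even.2 hh] at h2
      exact (commute_of_mem_parityGrading_zero h2 _).eq
  · have h1 : σ (1, g) ∈ parityGrading F (g : ZMod 2) := hσ 1 g
    have h2 : σ (2, h) ∈ parityGrading F (h : ZMod 2) := hσ 2 h
    rw [ZMod.intCast_eq_one_iff_odd.2 hg] at h1
    rw [ZMod.intCast_eq_one_iff_odd.2 hh] at h2
    simpa [x] using mul_add_mul_eq_zero_of_mem_parityGrading_one h1 h2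

theorem exists_mul_sub_smul_mul_mem_varCan (u v : ℕ × ℤ) : ∃ ε : F,
    (Odd u.2 → Odd v.2 → ε = -1) ∧ FreeAlgebra.ι F u * FreeAlgebra.ι F v -
      ε • (FreeAlgebra.ι F v * FreeAlgebra.ι F u) ∈ (varCan F).tIdeal := by
  -- Renaming subscript 1 to that of `u` and all others to that of `v` preserves degrees, so it
  -- carries the defining relations to the pair `u`, `v`, even when `u = v`.
  let φ : FreeGraded F ℤ →ₐ[F] FreeGraded F ℤ :=
    FreeAlgebra.lift F fun p => x F (if p.1 = 1 then u.1 else v.1) p.2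
  have hφ : IsGradedEnd φ := isGradedEnd_lift fun i g => x_mem_component _ _
  by_cases h : Odd u.2 ∧ Odd v.2
  · refine ⟨-1, fun _ _ => rfl, ?_⟩
    have := (varCan F).isTIdeal φ hφ _ (subset_tIdealSpan _ (Or.inr ⟨u.2, v.2, h, rfl⟩))
    simpa [φ, x] using this
  · refine ⟨1, fun hu hv => (h ⟨hu, hv⟩).elim, ?_⟩
    have h' : Even u.2 ∨ Even v.2 := by
      rwa [← Int.not_odd_iff_even, ← Int.not_odd_iff_even, ← not_and_or]
    have := (varCan F).isTIdeal φ hφ _ (subset_tIdealSpan _ (Or.inl ⟨u.2, v.2, h', rfl⟩))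
    simpa [φ, x] using this

theorem smul_mem_varCan (c : F) {f : FreeGraded F ℤ} (hf : f ∈ (varCan F).tIdeal) :
    c • f ∈ (varCan F).tIdeal := by
  rw [Algebra.smul_def]
  exact TwoSidedIdeal.mul_mem_left _ _ _ hf

theorem mul_self_mem_varCan [CharZero F] {v : ℕ × ℤ} (hv : Odd v.2) :
    FreeAlgebra.ι F v * FreeAlgebra.ι F v ∈ (varCan F).tIdeal := by
  obtain ⟨ε, hε, h⟩ := exists_mul_sub_smul_mul_mem_varCan (F := F) v v
  rw [hε hv hv, neg_one_smul, sub_neg_eq_add, ← two_smul F] at h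
  simpa using smul_mem_varCan (2⁻¹ : F) h

theorem exists_pow_mul_sub_smul_mul_pow_mem_varCan (u v : ℕ × ℤ) (d : ℕ) : ∃ ε : F,
    FreeAlgebra.ι F v ^ d * FreeAlgebra.ι F u - ε • (FreeAlgebra.ι F u * FreeAlgebra.ι F v ^ d) ∈
      (varCan F).tIdeal := by
  obtain ⟨ε, -, h⟩ := exists_mul_sub_smul_mul_mem_varCan (F := F) v u
  induction d with
  | zero => exact ⟨1, by simp⟩
  | succ d ih =>
    obtain ⟨η, hη⟩ := ih
    refine ⟨ε * η, ?_⟩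
    have h1 := TwoSidedIdeal.mul_mem_left _ (FreeAlgebra.ι F v ^ d) _ h
    have h2 := smul_mem_varCan ε (TwoSidedIdeal.mul_mem_right _ _ (FreeAlgebra.ι F v) hη)
    convert TwoSidedIdeal.add_mem _ h1 h2 using 1
    simp only [mul_sub, sub_mul, mul_smul_comm, smul_mul_assoc, smul_sub, smul_smul, pow_succ,
      mul_assoc]
    abel

/-- Modulo the identities of `varCan`, a chosen variable can be moved to the right. -/
theorem exists_sub_sum_mul_pow_mem_varCan {V : Finset (ℕ × ℤ)} {v : ℕ × ℤ} {f : FreeGraded F ℤ}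
    (hf : f ∈ Algebra.adjoin F (FreeAlgebra.ι F '' (insert v V : Set (ℕ × ℤ)))) :
    ∃ (D : Finset ℕ) (h : ℕ → FreeGraded F ℤ),
      (∀ d, h d ∈ Algebra.adjoin F (FreeAlgebra.ι F '' (V : Set (ℕ × ℤ)))) ∧
      f - ∑ d ∈ D, h d * FreeAlgebra.ι F v ^ d ∈ (varCan F).tIdeal := by
  set B := Algebra.adjoin F (FreeAlgebra.ι F '' (V : Set (ℕ × ℤ))) with hB
  let T : ℕ → Submodule F (FreeGraded F ℤ) := fun d =>
    (Subalgebra.toSubmodule B).map (LinearMap.mulRight F (FreeAlgebra.ι F v ^ d))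
  let J : Submodule F (FreeGraded F ℤ) :=
    (TwoSidedIdeal.asIdeal (varCan F).tIdeal).restrictScalars F
  have hJ : ∀ g, g ∈ J ↔ g ∈ (varCan F).tIdeal := fun g => by simp [J]
  -- `N` holds the elements of the desired normal form modulo the ideal. It is stable under right
  -- multiplication by every variable involved and contains 1, hence it contains `f`.
  let N : Submodule F (FreeGraded F ℤ) := (⨆ d, T d) ⊔ J
  have hT : ∀ d, ∀ g ∈ B, g * FreeAlgebra.ι F v ^ d ∈ N := fun d g hg =>
    Submodule.mem_sup_left (Submodule.mem_iSup_of_mem d ⟨g, hg, rfl⟩)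
  have step : ∀ u ∈ (insert v V : Set (ℕ × ℤ)), ∀ y ∈ N, y * FreeAlgebra.ι F u ∈ N := by
    intro u hu
    suffices N ≤ N.comap (LinearMap.mulRight F (FreeAlgebra.ι F u)) from this
    refine sup_le (iSup_le fun d => ?_) fun y hy =>
      Submodule.mem_sup_right ((hJ _).2 (TwoSidedIdeal.mul_mem_right _ _ _ ((hJ _).1 hy)))
    rintro _ ⟨g, hg, rfl⟩
    change g * FreeAlgebra.ι F v ^ d * FreeAlgebra.ι F u ∈ N
    rcases hu with rfl | hu
    · rw [mul_assoc, ← pow_succ]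
      exact hT _ g hg
    · obtain ⟨ε, hε⟩ := exists_pow_mul_sub_smul_mul_pow_mem_varCan (F := F) u v d
      have h1 : g * (FreeAlgebra.ι F v ^ d * FreeAlgebra.ι F u -
          ε • (FreeAlgebra.ι F u * FreeAlgebra.ι F v ^ d)) ∈ N :=
        Submodule.mem_sup_right ((hJ _).2 (TwoSidedIdeal.mul_mem_left _ _ _ hε))
      have h2 : ε • (g * FreeAlgebra.ι F u * FreeAlgebra.ι F v ^ d) ∈ N :=
        Submodule.smul_mem _ _ (hT d _ (mul_mem hg (Algebra.subset_adjoin ⟨u, hu, rfl⟩)))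
      convert add_mem h1 h2 using 1
      rw [mul_sub, mul_smul_comm, mul_assoc, mul_assoc, sub_add_cancel]
  have mul_mem' : ∀ y ∈ N, y * f ∈ N := by
    induction hf using Algebra.adjoin_induction with
    | mem g hg =>
      obtain ⟨u, hu, rfl⟩ := hg
      exact step u hu
    | algebraMap r =>
      intro y hy
      rw [← Algebra.commutes, ← Algebra.smul_def]
      exact Submodule.smul_mem _ _ hy
    | add g h _ _ hg hh => intro y hy; rw [mul_add]; exact add_mem (hg y hy) (hh y hy)
    | mul g h _ _ hg hh => intro y hy; rw [← mul_assoc]; exact hh _ (hg y hy)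
  have hfN : f ∈ N := by
    have := mul_mem' _ (hT 0 1 (one_mem _))
    simpa using this
  obtain ⟨y, hy, j, hj, rfl⟩ := Submodule.mem_sup.1 hfN
  obtain ⟨t, ht, rfl⟩ := (Submodule.mem_iSup_iff_exists_finsupp _ _).1 hy
  choose h hhB hh using ht
  refine ⟨t.support, h, hhB, ?_⟩
  rw [Finset.sum_congr rfl fun d _ => show h d * FreeAlgebra.ι F v ^ d = t d from hh d,
    show ∑ d ∈ t.support, t d = t.sum fun _ y => y from rfl, add_sub_cancel_left]
  exact (hJ j).1 hj

theorem hasFreeEven_true : HasFreeEven fun _ => True := by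
  intro W
  obtain ⟨s, hs, hcard⟩ := (W.finite_toSet.infinite_compl).exists_subset_card_eq 2
  refine ⟨s, ?_, ?_, ?_, trivial⟩
  · rw [Finset.disjoint_left]
    exact fun i hi hW => hs hi hW
  · rw [← Finset.card_pos, hcard]
    exact two_pos
  · rw [hcard]
    exact even_two

theorem evenSpan_le_parityGrading (P : Finset ℕ → Prop) : evenSpan F P ≤ parityGrading F 0 := by
  refine Submodule.span_le.2 ?_
  rintro _ ⟨s, -, hs, -, rfl⟩
  rw [SetLike.mem_coe, ← ZMod.natCast_eq_zero_iff_even.2 hs]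
  exact monomial_mem_parityGrading s

/-- Modulo the ideal, `f` is a sum of terms `h d * v ^ d` with `v` absent from `h d`. Substituting
for `v` alone separates the terms: each `h d` is again an identity and falls to the induction,
unless `v` is odd and `d ≥ 2`, where `v ^ d` is already in the ideal. -/
theorem mem_varCan_of_mem_adjoin [CharZero F] (V : Finset (ℕ × ℤ)) {f : FreeGraded F ℤ}
    (hfV : f ∈ Algebra.adjoin F (FreeAlgebra.ι F '' (V : Set (ℕ × ℤ))))
    (hf : f ∈ identities fun g : ℤ => parityGrading F (g : ZMod 2)) : f ∈ (varCan F).tIdeal := by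
  classical
  induction V using Finset.induction_on generalizing f with
  | empty =>
    rw [Finset.coe_empty, Set.image_empty, Algebra.adjoin_empty, Algebra.mem_bot] at hfV
    obtain ⟨r, rfl⟩ := hfV
    have h := hf 0 fun _ _ => zero_mem _
    rw [AlgHom.commutes, map_eq_zero_iff _ (algebraMap F (Grassmann F)).injective] at h
    rw [h, map_zero]
    exact TwoSidedIdeal.zero_mem _
  | insert v V hv ih =>
    rw [Finset.coe_insert] at hfV
    obtain ⟨D, h, hh, hfD⟩ := exists_sub_sum_mul_pow_mem_varCan hfV
    suffices hmem : ∀ d ∈ D, h d * FreeAlgebra.ι F v ^ d ∈ (varCan F).tIdeal by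
      have := TwoSidedIdeal.add_mem _ hfD (sum_mem hmem)
      rwa [sub_add_cancel] at this
    have heval : ∀ σ : ℕ × ℤ → Grassmann F,
        (∀ i g, σ (i, g) ∈ parityGrading F ((g : ℤ) : ZMod 2)) →
        ∀ w ∈ parityGrading F (v.2 : ZMod 2),
          ∑ d ∈ D, FreeAlgebra.lift F σ (h d) * w ^ d = 0 := by
      intro σ hσ w hw
      have hσ' : ∀ i g, Function.update σ v w (i, g) ∈ parityGrading F ((g : ℤ) : ZMod 2) := by
        intro i g
        by_cases hu : (i, g) = v
        · subst hu; simpa using hw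
        · simpa [hu] using hσ i g
      have h1 := varCan_subset_identities hfD _ hσ'
      rw [map_sub, hf _ hσ', zero_sub, neg_eq_zero, map_sum] at h1
      rw [← h1]
      refine Finset.sum_congr rfl fun d _ => ?_
      rw [map_mul, map_pow, FreeAlgebra.lift_ι_apply, Function.update_self]
      congr 1
      refine lift_congr_of_mem_adjoin (fun u hu => ?_) (hh d)
      rw [Function.update_of_ne]
      rintro rfl
      exact hv hu
    intro d hd
    rcases Int.even_or_odd v.2 with hv2 | hv2
    · refine TwoSidedIdeal.mul_mem_right _ _ _ (ih (hh d) fun σ hσ => ?_)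
      -- For even `v` the values range over all sums of non-empty even monomials, enough to kill
      -- every coefficient.
      let p : Polynomial (Grassmann F) :=
        ∑ e ∈ D, Polynomial.monomial e (FreeAlgebra.lift F σ (h e))
      have hp : p = 0 := by
        refine polynomial_eq_zero_of_eval_evenSpan hasFreeEven_true p fun z hz => ?_
        rw [Polynomial.eval_finsetSum]
        simp only [Polynomial.eval_monomial]
        refine heval σ hσ z ?_
        rw [ZMod.intCast_eq_zero_iff_even.2 hv2]
        exact evenSpan_le_parityGrading _ hz
      have := congrArg (fun q => Polynomial.coeff q d) hp
      simpa [p, Polynomial.finsetSum_coeff, Polynomial.coeff_monomial, hd] using this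
    -- For odd `v`, the value 0 isolates `h 0`, and the difference between the values at a fresh
    -- generator and at 0 isolates `h 1` times that generator. From exponent 2 on, the square of `v`
    -- lies in the ideal.
    · rcases d with _ | _ | d
      · refine TwoSidedIdeal.mul_mem_right _ _ _ (ih (hh 0) fun σ hσ => ?_)
        have := heval σ hσ 0 (zero_mem _)
        rw [Finset.sum_eq_single_of_mem 0 hd fun e _ he => by rw [zero_pow he, mul_zero]] at this
        simpa using this
      · refine TwoSidedIdeal.mul_mem_right _ _ _ (ih (hh _) fun σ hσ => ?_)
        obtain ⟨W, hW⟩ := exists_mem_supportedIn (FreeAlgebra.lift F σ (h (0 + 1)))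
        obtain ⟨i, hi⟩ := Infinite.exists_notMem_finset W
        refine eq_zero_of_mul_gen hi hW ?_
        have hgen : gen F i ∈ parityGrading F (v.2 : ZMod 2) := by
          rw [ZMod.intCast_eq_one_iff_odd.2 hv2]
          exact gen_mem_inducedGrading _ i
        have h0 := heval σ hσ 0 (zero_mem _)
        have h1 := heval σ hσ (gen F i) hgen
        have hsq : gen F i * gen F i = 0 := ExteriorAlgebra.ι_sq_zero _
        rw [← sub_eq_zero.2 (h1.trans h0.symm), ← Finset.sum_sub_distrib,
          Finset.sum_eq_single_of_mem _ hd]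
        · simp
        · rintro (_ | _ | e) _ he
          · simp
          · exact absurd rfl he
          · rw [pow_succ (gen F i), pow_succ (gen F i), mul_assoc (gen F i ^ e), hsq]
            simp
      · rw [pow_succ, pow_succ, mul_assoc]
        exact TwoSidedIdeal.mul_mem_left _ _ _
          (TwoSidedIdeal.mul_mem_left _ _ _ (mul_self_mem_varCan hv2))

end GradedVariety

namespace GradedVariety

theorem isGeneratedBy_varCan {F : Type*} [Field F] [CharZero F] {deg : ℕ → ℤ}
    (hdeg : HasEvenMonomials deg) (hodd : ∀ i, Odd (deg i)) :
    (varCan F).IsGeneratedBy (inducedGrading F deg) := by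
  rw [IsGeneratedBy, identities_inducedGrading_eq_mod_two hdeg,
    show (fun i => (deg i : ZMod 2)) = fun _ => 1 from
      funext fun i => ZMod.intCast_eq_one_iff_odd.2 (hodd i)]
  refine subset_antisymm varCan_subset_identities fun f hf => ?_
  obtain ⟨V, hV⟩ := exists_finset_mem_adjoin f
  exact mem_varCan_of_mem_adjoin V hV hf

end GradedVariety

/-! ### Degrees reachable from `a` and `-b` -/

theorem exists_natCast_mul_sub_eq {a b : ℤ} (ha : 0 < a) (hb : 0 < b) (hab : Int.gcd a b = 1)
    (r : ℤ) : ∃ x y : ℕ, 0 < x ∧ x * a - y * b = r ∧ (Even r → Even (x + y)) := by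
  have hbez := Int.gcd_eq_gcd_ab a b
  rw [hab, Nat.cast_one] at hbez
  set u := Int.gcdA a b
  set v := Int.gcdB a b
  -- The Bézout solution `(r u, -r v)` is shifted by `2t (b, a)`: `t` exceeds `|r u|` and `|r v|`,
  -- making both entries positive, and the factor 2 leaves the parity of their sum unchanged.
  set t := 1 + |r * u| + |r * v| with ht
  have ht0 : 0 < t := by positivity
  have hx : 0 < r * u + b * (2 * t) := by
    nlinarith [neg_abs_le (r * u), abs_nonneg (r * v), abs_nonneg (r * u)]
  have hy : 0 < -(r * v) + a * (2 * t) := by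
    nlinarith [le_abs_self (r * v), abs_nonneg (r * v), abs_nonneg (r * u)]
  lift r * u + b * (2 * t) to ℕ using hx.le with x hx'
  lift -(r * v) + a * (2 * t) to ℕ using hy.le with y hy'
  refine ⟨x, y, by exact_mod_cast hx, ?_, ?_⟩
  · rw [hx', hy']
    linear_combination (-r) * hbez
  · intro hr
    rw [← Int.even_coe_nat, Nat.cast_add, hx', hy']
    obtain ⟨q, rfl⟩ := hr
    exact ⟨q * u - q * v + (a + b) * t, by ring⟩

namespace Grassmann

theorem exists_disjoint_sum_eq {a b : ℤ} (ha : 0 < a) (hb : 0 < b) (hab : Int.gcd a b = 1)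
    {deg : ℕ → ℤ} (hA : {i | deg i = a}.Infinite) (hB : {i | deg i = -b}.Infinite)
    (W : Finset ℕ) (r : ℤ) : ∃ s : Finset ℕ, Disjoint s W ∧ s.Nonempty ∧ (Even r → Even s.card) ∧
      ∑ i ∈ s, deg i = r := by
  obtain ⟨x, y, hx, hr, hxy⟩ := exists_natCast_mul_sub_eq ha hb hab r
  obtain ⟨s, hs, rfl⟩ := (hA.sdiff W.finite_toSet).exists_subset_card_eq x
  obtain ⟨t, ht, rfl⟩ := (hB.sdiff W.finite_toSet).exists_subset_card_eq y
  have hst : Disjoint s t := by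
    rw [Finset.disjoint_left]
    intro i his hit
    have h1 : deg i = a := (hs his).1
    have h2 : deg i = -b := (ht hit).1
    lia
  refine ⟨s ∪ t, ?_, (Finset.card_pos.1 hx).mono Finset.subset_union_left, ?_, ?_⟩
  · rw [Finset.disjoint_union_left, Finset.disjoint_left, Finset.disjoint_left]
    exact ⟨fun i hi => (hs hi).2, fun i hi => (ht hi).2⟩
  · rwa [Finset.card_union_of_disjoint hst]
  · rw [Finset.sum_union hst, Finset.sum_congr rfl fun i hi => (hs hi).1,
      Finset.sum_congr rfl fun i hi => (ht hi).1]
    simpa [sub_eq_add_neg] using hr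

end Grassmann

/-! ### Gradings with the three degrees `-b`, `c`, `a` -/

namespace Grassmann.IsInducedDegree

theorem infinite_left {a b c : ℤ} {k : ℕ∞} {deg : ℕ → ℤ}
    (h : IsInducedDegree ![-b, c, a] ![⊤, k, ⊤] deg) : {i | deg i = -b}.Infinite :=
  Set.encard_eq_top_iff.1 (h.encard_eq 0)

theorem encard_middle {a b c : ℤ} {k : ℕ∞} {deg : ℕ → ℤ}
    (h : IsInducedDegree ![-b, c, a] ![⊤, k, ⊤] deg) : {i | deg i = c}.encard = k :=
  h.encard_eq 1

theorem infinite_right {a b c : ℤ} {k : ℕ∞} {deg : ℕ → ℤ}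
    (h : IsInducedDegree ![-b, c, a] ![⊤, k, ⊤] deg) : {i | deg i = a}.Infinite :=
  Set.encard_eq_top_iff.1 (h.encard_eq 2)

theorem eq_or_eq_or_eq {a b c : ℤ} {k : ℕ∞} {deg : ℕ → ℤ}
    (h : IsInducedDegree ![-b, c, a] ![⊤, k, ⊤] deg) (i : ℕ) :
    deg i = -b ∨ deg i = c ∨ deg i = a := by
  obtain ⟨j, hj⟩ := h.mem_range i
  fin_cases j
  · exact Or.inl hj
  · exact Or.inr (Or.inl hj)
  · exact Or.inr (Or.inr hj)

theorem hasEvenMonomials {a b c : ℤ} (ha : 0 < a) (hb : 0 < b) (hab : Int.gcd a b = 1) {k : ℕ∞}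
    {deg : ℕ → ℤ} (h : IsInducedDegree ![-b, c, a] ![⊤, k, ⊤] deg) : HasEvenMonomials deg := by
  intro r hr W
  obtain ⟨s, hsW, hs0, hs2, hs⟩ :=
    exists_disjoint_sum_eq ha hb hab h.infinite_right h.infinite_left W r
  exact ⟨s, hsW, hs0, hs2 hr, hs⟩

end Grassmann.IsInducedDegree

namespace GradedVariety

variable {F : Type*} [Field F] [CharZero F] {a b c : ℤ} {deg : ℕ → ℤ}

theorem isGeneratedBy_varCan_of_isInducedDegree {k : ℕ∞} (ha : 0 < a) (hb : 0 < b)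
    (hab : Int.gcd a b = 1) (h : IsInducedDegree ![-b, c, a] ![⊤, k, ⊤] deg)
    (hodd : Odd (a * b * c)) : (varCan F).IsGeneratedBy (inducedGrading F deg) := by
  obtain ⟨⟨hao, hbo⟩, hco⟩ := by rwa [Int.odd_mul, Int.odd_mul] at hodd
  refine isGeneratedBy_varCan (h.hasEvenMonomials ha hb hab) fun i => ?_
  rcases h.eq_or_eq_or_eq i with hi | hi | hi <;> rw [hi]
  exacts [hbo.neg, hco, hao]

theorem isGeneratedBy_var102_of_isInducedDegree {k : ℕ∞} (ha : 0 < a) (hb : 0 < b)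
    (hab : Int.gcd a b = 1) (h : IsInducedDegree ![-b, c, a] ![⊤, k, ⊤] deg)
    (heven : Even (a * b)) : (var102 F).IsGeneratedBy (inducedGrading F deg) := by
  refine isGeneratedBy_var102 (h.hasEvenMonomials ha hb hab) ?_ ?_
  · rcases Int.even_mul.1 heven with hp | hp
    · exact h.infinite_right.mono fun i (hi : deg i = a) => show Even (deg i) from hi ▸ hp
    · exact h.infinite_left.mono fun i (hi : deg i = -b) => show Even (deg i) from hi ▸ hp.neg
  -- By coprimality `a` and `b` are not both even, so one of the two infinite families is odd.
  · rcases Int.even_or_odd a with hae | hao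
    · rcases Int.even_or_odd b with hbe | hbo
      · have := Int.dvd_coe_gcd hae.two_dvd hbe.two_dvd
        rw [hab] at this
        norm_num at this
      · exact h.infinite_left.mono fun i (hi : deg i = -b) => show Odd (deg i) from hi ▸ hbo.neg
    · exact h.infinite_right.mono fun i (hi : deg i = a) => show Odd (deg i) from hi ▸ hao

end GradedVariety

theorem mainTheorem5 (F : Type*) [Field F] [CharZero F] (a b c : ℤ) (ha : 0 < a) (hb : 0 < b)
    (hbc : -b < c) (hca : c < a) (hab : Int.gcd a b = 1) (hc : c ≠ 0) :
    (∀ (k : ℕ∞) (deg : ℕ → ℤ),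
      Grassmann.IsInducedDegree ![-b, c, a] ![⊤, k, ⊤] deg →
        Grassmann.IsIntCentralGrading 2 (Grassmann.inducedGrading F deg)) ∧
    (∀ (k : ℕ) (deg : ℕ → ℤ),
      Grassmann.IsInducedDegree ![-b, c, a] ![⊤, (k : ℕ∞), ⊤] deg →
        (Odd (a * b) → Even c →
          (GradedVariety.var101 F k).IsGeneratedBy (Grassmann.inducedGrading F deg)) ∧
        (Even (a * b) →
          (GradedVariety.var102 F).IsGeneratedBy (Grassmann.inducedGrading F deg)) ∧
        (Odd (a * b * c) →
          (GradedVariety.varCan F).IsGeneratedBy (Grassmann.inducedGrading F deg))) ∧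
    (∀ deg : ℕ → ℤ,
      Grassmann.IsInducedDegree ![-b, c, a] ![⊤, ⊤, ⊤] deg →
        (Even (a * b * c) →
          (GradedVariety.var102 F).IsGeneratedBy (Grassmann.inducedGrading F deg)) ∧
        (Odd (a * b * c) →
          (GradedVariety.varCan F).IsGeneratedBy (Grassmann.inducedGrading F deg))) := by
  refine ⟨fun k deg h => ?_, fun k deg h => ⟨fun hodd heven => ?_, ?_, ?_⟩,
    fun deg h => ⟨fun heven => ?_, ?_⟩⟩
  · refine isIntCentralGrading_two (h.hasEvenMonomials ha hb hab) fun r => ?_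
    obtain ⟨s, -, -, -, hs⟩ :=
      exists_disjoint_sum_eq ha hb hab h.infinite_right h.infinite_left ∅ r
    exact ⟨s, hs⟩
  · obtain ⟨hao, hbo⟩ := Int.odd_mul.1 hodd
    refine isGeneratedBy_var101 (h.hasEvenMonomials ha hb hab) ?_
      (h.infinite_right.mono fun i (hi : deg i = a) => show Odd (deg i) from hi ▸ hao)
    -- With `a` and `b` odd and `c` even, the generators of even degree are exactly those of degree
    -- `c`.
    rw [← h.encard_middle]
    congr 1
    ext i
    change Even (deg i) ↔ deg i = c
    refine ⟨fun hi => ?_, fun hi => hi ▸ heven⟩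
    rcases h.eq_or_eq_or_eq i with hi' | hi' | hi'
    · exact absurd hi (Int.not_even_iff_odd.2 (hi' ▸ hbo.neg))
    · exact hi'
    · exact absurd hi (Int.not_even_iff_odd.2 (hi' ▸ hao))
  · exact GradedVariety.isGeneratedBy_var102_of_isInducedDegree ha hb hab h
  · exact GradedVariety.isGeneratedBy_varCan_of_isInducedDegree ha hb hab h
  -- If `a * b` is odd, then `c` is even and the infinitely many generators of degree `c` supply the
  -- even ones.
  · rcases Int.even_or_odd (a * b) with hab2 | hodd
    · exact GradedVariety.isGeneratedBy_var102_of_isInducedDegree ha hb hab h hab2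
    · obtain ⟨hao, hbo⟩ := Int.odd_mul.1 hodd
      have hce : Even c := (Int.even_mul.1 heven).resolve_left (Int.not_even_iff_odd.2 hodd)
      refine isGeneratedBy_var102 (h.hasEvenMonomials ha hb hab)
        ((Set.encard_eq_top_iff.1 h.encard_middle).mono
          fun i (hi : deg i = c) => show Even (deg i) from hi ▸ hce)
        (h.infinite_right.mono fun i (hi : deg i = a) => show Odd (deg i) from hi ▸ hao)
  · exact GradedVariety.isGeneratedBy_varCan_of_isInducedDegree ha hb hab h
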